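/- Let $A$ be a real $n_2\times n_1$ matrix with singular values $\sigma_1\ge\sigma_2\ge\cdots\ge\sigma_{\min\{n_1,n_2\}}$, and set $\sigma_j=0$ for $j>\min\{n_1,n_2\}$. Choose a target rank $1\le k\le n_1$ and an integer oversampling parameter $p\ge 2$. Let $\Omega$ be a random $n_1\times(k+p)$ matrix with independent columns, each of which has the multivariate Gaussian distribution with mean $(0,\dots,0)^\top$ and positive definite covariance matrix $K$, and let $\lambda_1\ge\cdots\ge\lambda_{n_1}>0$ be the eigenvalues of $K$. Put $Y=A\Omega$ and let $P_Y$ be the orthogonal projection onto the vector space spanned by the columns of $Y$. Then $$\mathbb{E}\left[\|A-P_YA\|_{\mathrm F}\right]\le\left(1+\sqrt{\frac{k+p}{p-1}\sum_{j=n_1-k+1}^{n_1}\frac{\lambda_1}{\lambda_j}}\right)\left(\sum_{j=k+1}^{\infty}\sigma_j^2\right)^{1/2}.$$ If moreover $p\ge 4$, then for all real $s,t\ge 1$, with probability at least $1-t^{-p}-\left[s\,e^{-(s^2-1)/2}\right]^{k+p}$, $$\|A-P_YA\|_{\mathrm F}\le\left(1+ts\sqrt{\frac{3(k+p)}{p+1}\left(\sum_{j=1}^{n_1}\lambda_j\right)\sum_{j=n_1-k+1}^{n_1}\frac{1}{\lambda_j}}\right)\left(\sum_{j=k+1}^{\infty}\sigma_j^2\right)^{1/2}.$$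 -/

import Mathlib

open MeasureTheory ProbabilityTheory
open scoped Matrix.Norms.Frobenius

/-- The eigenvalues of a real symmetric `n × n` matrix, with multiplicity, in decreasing order:
`sortedEigenvalues hK 0 ≥ sortedEigenvalues hK 1 ≥ ⋯`. -/
noncomputable def sortedEigenvalues {n : ℕ} {K : Matrix (Fin n) (Fin n) ℝ}
    (hK : K.IsHermitian) (j : Fin n) : ℝ :=
  hK.eigenvalues₀ (Fin.cast (Fintype.card_fin n).symm j)

theorem sortedEigenvalues_antitone {n : ℕ} {K : Matrix (Fin n) (Fin n) ℝ}
    (hK : K.IsHermitian) : Antitone (sortedEigenvalues hK) :=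
  fun _ _ h => hK.eigenvalues₀_antitone h

/-- The `j`-th column of a matrix, as a vector of Euclidean space. -/
noncomputable def euclideanCol {m n : ℕ} (M : Matrix (Fin m) (Fin n) ℝ) (j : Fin n) :
    EuclideanSpace ℝ (Fin m) :=
  WithLp.toLp 2 (M.col j)

/-- The space spanned by the columns of a matrix. -/
noncomputable def columnSpace {m n : ℕ} (Y : Matrix (Fin m) (Fin n) ℝ) :
    Submodule ℝ (EuclideanSpace ℝ (Fin m)) :=
  Submodule.span ℝ (Set.range (euclideanCol Y))

/-- The matrix of the orthogonal projection of Euclidean space onto the space spanned by the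
columns of `Y`. -/
noncomputable def columnProjection {m n : ℕ} (Y : Matrix (Fin m) (Fin n) ℝ) :
    Matrix (Fin m) (Fin m) ℝ :=
  (Matrix.toEuclideanCLM (n := Fin m) (𝕜 := ℝ)).symm (columnSpace Y).starProjection

/-- The singular values of a matrix, zero-indexed: `singularValue A j` is the `(j + 1)`-st largest
singular value, and it is zero once `j` is at least the number of rows or columns. -/
noncomputable def singularValue {m n : ℕ} (A : Matrix (Fin m) (Fin n) ℝ) (j : ℕ) : ℝ :=
  (Matrix.toEuclideanLin A).singularValues j

/-- `X` is a random matrix whose columns are independent and each distributed as a multivariate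
Gaussian of mean zero and covariance matrix `K`. -/
structure IsGaussianSketch {Θ : Type*} [MeasurableSpace Θ] (P : Measure Θ) {n ℓ : ℕ}
    (K : Matrix (Fin n) (Fin n) ℝ) (X : Θ → Matrix (Fin n) (Fin ℓ) ℝ) : Prop where
  indep : iIndepFun (fun (j : Fin ℓ) (θ : Θ) => euclideanCol (X θ) j) P
  law : ∀ j : Fin ℓ, HasLaw (fun θ => euclideanCol (X θ) j) (multivariateGaussian 0 K) P

/-! Let the rows of V be top k right singular vectors of A and put B = A - AVᵀV, whose Frobenius
norm is the singular value tail. Since P_Y A is the best approximation of A of the form YX, every X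
bounds the error. For X = (VΩ)⁺V one has VΩX = V, hence A - YX = B - BΩX, and the error is at most
‖B‖ + ‖BΩ‖‖X‖ (`norm_sub_columnProjection_mul_le_add`).

Rotating the rows of V makes VKVᵀ = diag(d) without changing VᵀV. Then G = diag(d)^(-1/2) VΩ is a
standard Gaussian matrix and ‖X‖² is the sum of the diagonal entries of (GGᵀ)⁻¹ with weights 1/d_i.
Such an entry is the inverse squared distance of a row of G from the span of the others, the
reciprocal of a chi-squared variable with p+1 degrees of freedom (`lintegral_gramInv_rpow_le`). The
weights are controlled by the smallest eigenvalues of K (`sum_inv_diag_le`). After whitening, ‖BΩ‖²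
is a sum of weighted squares of independent Gaussians, with total weight tr(BKBᵀ) ≤ λ₁‖B‖² in each
column.

BΩ and VΩ are in general dependent. The expectation therefore uses Cauchy–Schwarz on the second
moments; the tail uses a union bound, with Markov for the p/2-th moment of ‖X‖² and Chernoff for
‖BΩ‖². -/

/-! ### Exponential moments of Gaussian quadratic forms -/

theorem lintegral_rpow_mul_exp_neg_mul_Ioi {a r : ℝ} (ha : 0 < a) (hr : 0 < r) :
    ∫⁻ t in Set.Ioi (0 : ℝ), ENNReal.ofReal (t ^ (a - 1) * Real.exp (-(r * t))) =
      ENNReal.ofReal ((1 / r) ^ a * Real.Gamma a) := by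
  have h := Real.integral_rpow_mul_exp_neg_mul_Ioi ha hr
  have hpos : 0 < (1 / r) ^ a * Real.Gamma a :=
    mul_pos (Real.rpow_pos_of_pos (by positivity) _) (Real.Gamma_pos_of_pos ha)
  rw [← h, ofReal_integral_eq_lintegral_ofReal]
  -- A Bochner integral with nonzero value certifies integrability, since the default value is 0.
  · exact not_imp_comm.1 integral_undef (by rw [h]; exact hpos.ne')
  · filter_upwards [ae_restrict_mem measurableSet_Ioi] with t ht
    have : (0 : ℝ) < t := ht
    positivity

theorem lintegral_gaussianReal_exp_mul_sq {c : ℝ} (hc : c < 1 / 2) :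
    ∫⁻ x, ENNReal.ofReal (Real.exp (c * x ^ 2)) ∂gaussianReal 0 1 =
      ENNReal.ofReal ((1 - 2 * c) ^ (-(1 / 2) : ℝ)) := by
  have hb : 0 < 1 / 2 - c := by linarith
  have hval : ∀ x : ℝ, gaussianPDFReal 0 1 x • Real.exp (c * x ^ 2) =
      (√(2 * Real.pi))⁻¹ * Real.exp (-(1 / 2 - c) * x ^ 2) := by
    intro x
    rw [gaussianPDFReal, smul_eq_mul, mul_assoc, ← Real.exp_add]
    congr 2
    · norm_num
    · push_cast
      ring_nf
  have h : ∫ x, Real.exp (c * x ^ 2) ∂gaussianReal 0 1 = (1 - 2 * c) ^ (-(1 / 2) : ℝ) := by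
    rw [integral_gaussianReal_eq_integral_smul one_ne_zero]
    simp_rw [hval]
    rw [integral_const_mul, integral_gaussian, Real.rpow_neg (by linarith), ← Real.sqrt_eq_rpow,
      ← Real.sqrt_inv, ← Real.sqrt_inv, ← Real.sqrt_mul (by positivity)]
    congr 1
    have : 1 - 2 * c ≠ 0 := by linarith
    have h3 : (1 / 2 - c) ≠ 0 := hb.ne'
    have := Real.pi_pos.ne'
    field_simp
  rw [← h, ofReal_integral_eq_lintegral_ofReal]
  · refine not_imp_comm.1 integral_undef ?_
    rw [h]
    exact (Real.rpow_pos_of_pos (by linarith) _).ne'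
  · filter_upwards with x using (Real.exp_pos _).le

theorem lintegral_pi_gaussianReal_exp_sum_sq {ι : Type*} [Fintype ι] {a : ι → ℝ}
    (ha : ∀ i, a i < 1 / 2) :
    ∫⁻ x, ENNReal.ofReal (Real.exp (∑ i, a i * x i ^ 2))
        ∂Measure.pi (fun _ : ι => gaussianReal 0 1) =
      ENNReal.ofReal (∏ i, (1 - 2 * a i) ^ (-(1 / 2) : ℝ)) := by
  have hind : iIndepFun (fun (i : ι) (x : ι → ℝ) => ENNReal.ofReal (Real.exp (a i * x i ^ 2)))
      (Measure.pi (fun _ : ι => gaussianReal 0 1)) :=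
    iIndepFun_pi (X := fun i (x : ℝ) => ENNReal.ofReal (Real.exp (a i * x ^ 2)))
      (fun i => by fun_prop)
  have := lintegral_prod_eq_prod_lintegral_of_indepFun Finset.univ _ hind (fun i => by fun_prop)
  rw [ENNReal.ofReal_prod_of_nonneg
    (fun i _ => Real.rpow_nonneg (by linarith [ha i]) _)]
  simp_rw [Real.exp_sum]
  simp_rw [ENNReal.ofReal_prod_of_nonneg (fun i _ => (Real.exp_pos _).le)]
  rw [this]
  refine Finset.prod_congr rfl fun i _ => ?_
  rw [← lintegral_gaussianReal_exp_mul_sq (ha i)]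
  exact (measurePreserving_eval (fun _ : ι => gaussianReal 0 1) i).lintegral_comp
    (f := fun x : ℝ => ENNReal.ofReal (Real.exp (a i * x ^ 2))) (by fun_prop)

theorem one_sub_sum_le_prod_one_sub {ι : Type*} (s : Finset ι) {f : ι → ℝ}
    (h0 : ∀ i ∈ s, 0 ≤ f i) (h1 : ∑ i ∈ s, f i ≤ 1) :
    1 - ∑ i ∈ s, f i ≤ ∏ i ∈ s, (1 - f i) := by
  classical
  induction s using Finset.induction_on with
  | empty => simp
  | insert a s ha ih =>
    rw [Finset.sum_insert ha, Finset.prod_insert ha] at *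
    have h2 : 0 ≤ f a := h0 a (by simp)
    have h3 : 0 ≤ ∑ i ∈ s, f i := Finset.sum_nonneg fun i hi => h0 i (by simp [hi])
    have h4 := ih (fun i hi => h0 i (by simp [hi])) (by linarith)
    nlinarith [mul_nonneg h2 h3]

/-- By the Weierstrass product inequality the worst case has all the weight on one coordinate, so
the bound depends only on the total weight. -/
theorem lintegral_pi_gaussianReal_exp_sum_sq_le {ι : Type*} [Fintype ι] {a : ι → ℝ} {b : ℝ}
    (ha : ∀ i, 0 ≤ a i) (hab : ∑ i, a i ≤ b) (hb : b < 1 / 2) :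
    ∫⁻ x, ENNReal.ofReal (Real.exp (∑ i, a i * x i ^ 2))
        ∂Measure.pi (fun _ : ι => gaussianReal 0 1) ≤
      ENNReal.ofReal ((1 - 2 * b) ^ (-(1 / 2) : ℝ)) := by
  have hi : ∀ i, a i < 1 / 2 := fun i =>
    ((Finset.single_le_sum (fun j _ => ha j) (Finset.mem_univ i)).trans hab).trans_lt hb
  rw [lintegral_pi_gaussianReal_exp_sum_sq hi,
    Real.finsetProd_rpow _ _ (fun i _ => by linarith [hi i])]
  refine ENNReal.ofReal_le_ofReal (Real.rpow_le_rpow_of_nonpos (by linarith) ?_ (by norm_num))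
  have := one_sub_sum_le_prod_one_sub Finset.univ (f := fun i => 2 * a i)
    (fun i _ => by linarith [ha i]) (by rw [← Finset.mul_sum]; linarith)
  rw [← Finset.mul_sum] at this
  linarith

theorem lintegral_pi_gaussianReal_sum_sq {ι : Type*} [Fintype ι] (a : ι → ℝ)
    (ha : ∀ i, 0 ≤ a i) :
    ∫⁻ x, ENNReal.ofReal (∑ i, a i * x i ^ 2) ∂Measure.pi (fun _ : ι => gaussianReal 0 1) =
      ENNReal.ofReal (∑ i, a i) := by
  have h2 : ∫⁻ x, ENNReal.ofReal (x ^ 2) ∂gaussianReal 0 1 = 1 := by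
    have hv := variance_id_gaussianReal (μ := 0) (v := 1)
    rw [variance_of_integral_eq_zero (by fun_prop) (by simp)] at hv
    rw [← ofReal_integral_eq_lintegral_ofReal]
    · simpa using! congrArg ENNReal.ofReal hv
    · refine not_imp_comm.1 integral_undef ?_
      simp only [id] at hv
      rw [hv]; simp
    · filter_upwards with x using sq_nonneg x
  have : ∀ x : ι → ℝ, ENNReal.ofReal (∑ i, a i * x i ^ 2) =
      ∑ i, ENNReal.ofReal (a i) * ENNReal.ofReal (x i ^ 2) := fun x => by
    rw [ENNReal.ofReal_sum_of_nonneg (fun i _ => mul_nonneg (ha i) (sq_nonneg _))]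
    exact Finset.sum_congr rfl fun i _ => ENNReal.ofReal_mul (ha i)
  simp_rw [this]
  rw [lintegral_finsetSum _ (fun i _ => by fun_prop),
    ENNReal.ofReal_sum_of_nonneg (fun i _ => ha i)]
  refine Finset.sum_congr rfl fun i _ => ?_
  rw [lintegral_const_mul _ (by fun_prop)]
  have := (measurePreserving_eval (fun _ : ι => gaussianReal 0 1) i).lintegral_comp
    (f := fun x : ℝ => ENNReal.ofReal (x ^ 2)) (by fun_prop)
  erw [this]
  rw [h2, mul_one]

/-! ### Negative moments of chi-squared variables -/

/-- The moment of order `-q` of a chi-squared variable with `m` degrees of freedom. -/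
noncomputable def invChiSqMoment (m q : ℝ) : ℝ :=
  (1 / 2) ^ q * Real.Gamma (m / 2 - q) / Real.Gamma (m / 2)

/-- Euler's integral for the Gamma function, with equality for positive `a`. At `a = 0` the integral
diverges, so the infinite value on the left is covered too. -/
theorem ofReal_rpow_neg_le_lintegral {a q : ℝ} (ha : 0 ≤ a) (hq : 0 < q) :
    ENNReal.ofReal a ^ (-q) ≤ ENNReal.ofReal (Real.Gamma q)⁻¹ *
      ∫⁻ t in Set.Ioi (0 : ℝ), ENNReal.ofReal (t ^ (q - 1) * Real.exp (-(a * t))) := by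
  have hG := Real.Gamma_pos_of_pos hq
  rcases ha.eq_or_lt with rfl | ha
  · have : ∫⁻ t in Set.Ioi (0 : ℝ), ENNReal.ofReal (t ^ (q - 1) * Real.exp (-(0 * t))) = ⊤ := by
      by_contra hne
      refine not_integrableOn_Ioi_rpow (q - 1) ⟨by fun_prop, ?_⟩
      rw [hasFiniteIntegral_iff_ofReal]
      · simpa [lt_top_iff_ne_top] using hne
      · filter_upwards [ae_restrict_mem measurableSet_Ioi] with t ht
        exact Real.rpow_nonneg (le_of_lt ht) _
    rw [this, ENNReal.mul_top]
    · exact le_top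
    · simpa using hG
  · rw [lintegral_rpow_mul_exp_neg_mul_Ioi hq ha, ← ENNReal.ofReal_mul (by positivity),
      ENNReal.ofReal_rpow_of_pos ha]
    refine ENNReal.ofReal_le_ofReal (le_of_eq ?_)
    rw [Real.rpow_neg ha.le, one_div, Real.inv_rpow ha.le]
    field_simp

/-- Euler's integral and Tonelli reduce the moment to the Laplace transform (1+2t)^(-m/2). This is
again written as a Gamma integral, in a new variable y; after a second exchange the t-integral gives
(2y)^(-q) Γ(q), and what remains is Γ(m/2 - q). -/
theorem lintegral_pi_gaussianReal_rpow_neg_le {ι : Type*} [Fintype ι] (S : Finset ι) {q : ℝ}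
    (hq : 0 < q) (hqS : q < (S.card : ℝ) / 2) :
    ∫⁻ x, ENNReal.ofReal (∑ i ∈ S, x i ^ 2) ^ (-q)
        ∂Measure.pi (fun _ : ι => gaussianReal 0 1) ≤
      ENNReal.ofReal (invChiSqMoment S.card q) := by
  classical
  set m : ℝ := (S.card : ℝ)
  have hm : 0 < m / 2 := hq.trans hqS
  have hGq := Real.Gamma_pos_of_pos hq
  have hGm := Real.Gamma_pos_of_pos hm
  have hE : ∀ t ∈ Set.Ioi (0 : ℝ), ∫⁻ x, ENNReal.ofReal (Real.exp (-((∑ i ∈ S, x i ^ 2) * t)))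
        ∂Measure.pi (fun _ : ι => gaussianReal 0 1) =
      ENNReal.ofReal ((1 + 2 * t) ^ (-(m / 2))) := by
    intro t ht
    have ht : (0 : ℝ) < t := ht
    have hs : ∀ x : ι → ℝ, -((∑ i ∈ S, x i ^ 2) * t) =
        ∑ i, (if i ∈ S then -t else 0) * x i ^ 2 := fun x => by
      simp only [ite_mul, zero_mul, Finset.sum_ite_mem, Finset.univ_inter, ← Finset.mul_sum]
      ring
    simp_rw [hs]
    rw [lintegral_pi_gaussianReal_exp_sum_sq (fun i => by split_ifs <;> linarith)]
    congr 1
    have : ∀ i, (1 - 2 * (if i ∈ S then -t else 0)) ^ (-(1 / 2) : ℝ) =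
        if i ∈ S then (1 + 2 * t) ^ (-(1 / 2) : ℝ) else 1 := fun i => by
      split_ifs <;> simp
    simp_rw [this]
    rw [Finset.prod_ite_mem, Finset.univ_inter, Finset.prod_const, ← Real.rpow_natCast,
      ← Real.rpow_mul (by linarith)]
    congr 1
    ring
  calc _ ≤ ∫⁻ x, ENNReal.ofReal (Real.Gamma q)⁻¹ * (∫⁻ t in Set.Ioi (0 : ℝ),
        ENNReal.ofReal (t ^ (q - 1) * Real.exp (-((∑ i ∈ S, x i ^ 2) * t))))
        ∂Measure.pi (fun _ : ι => gaussianReal 0 1) :=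
      lintegral_mono fun x => ofReal_rpow_neg_le_lintegral
        (Finset.sum_nonneg fun i _ => sq_nonneg _) hq
    _ = ENNReal.ofReal (Real.Gamma q)⁻¹ * ∫⁻ t in Set.Ioi (0 : ℝ), ∫⁻ x,
        ENNReal.ofReal (t ^ (q - 1) * Real.exp (-((∑ i ∈ S, x i ^ 2) * t)))
        ∂Measure.pi (fun _ : ι => gaussianReal 0 1) := by
      rw [lintegral_const_mul' _ _ ENNReal.ofReal_ne_top, lintegral_lintegral_swap]
      exact Measurable.aemeasurable (by fun_prop)
    _ = ENNReal.ofReal (Real.Gamma q)⁻¹ * ∫⁻ t in Set.Ioi (0 : ℝ),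
        ENNReal.ofReal (Real.Gamma (m / 2))⁻¹ * ∫⁻ y in Set.Ioi (0 : ℝ),
        ENNReal.ofReal (t ^ (q - 1) * (y ^ (m / 2 - 1) * Real.exp (-((1 + 2 * t) * y)))) := by
      congr 1
      refine setLIntegral_congr_fun measurableSet_Ioi fun t ht => ?_
      have ht' : (0 : ℝ) < t := ht
      have h1 : (0 : ℝ) ≤ t ^ (q - 1) := Real.rpow_nonneg ht'.le _
      simp_rw [ENNReal.ofReal_mul h1]
      rw [lintegral_const_mul' _ _ ENNReal.ofReal_ne_top,
        lintegral_const_mul' _ _ ENNReal.ofReal_ne_top, hE t ht,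
        lintegral_rpow_mul_exp_neg_mul_Ioi hm (by linarith), mul_left_comm,
        ← ENNReal.ofReal_mul (inv_nonneg.2 hGm.le)]
      congr 2
      rw [Real.rpow_neg (by linarith), one_div, Real.inv_rpow (by linarith)]
      field_simp
    _ = ENNReal.ofReal (Real.Gamma q)⁻¹ * (ENNReal.ofReal (Real.Gamma (m / 2))⁻¹ *
        ∫⁻ y in Set.Ioi (0 : ℝ), ∫⁻ t in Set.Ioi (0 : ℝ),
        ENNReal.ofReal (t ^ (q - 1) * (y ^ (m / 2 - 1) * Real.exp (-((1 + 2 * t) * y))))) := by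
      rw [lintegral_const_mul' _ _ ENNReal.ofReal_ne_top, lintegral_lintegral_swap]
      exact Measurable.aemeasurable (by fun_prop)
    _ = ENNReal.ofReal (Real.Gamma q)⁻¹ * (ENNReal.ofReal (Real.Gamma (m / 2))⁻¹ *
        ∫⁻ y in Set.Ioi (0 : ℝ), ENNReal.ofReal ((1 / 2) ^ q * Real.Gamma q) *
        ENNReal.ofReal (y ^ (m / 2 - q - 1) * Real.exp (-(1 * y)))) := by
      congr 2
      refine setLIntegral_congr_fun measurableSet_Ioi fun y hy => ?_
      have hy' : (0 : ℝ) < y := hy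
      have h1 : (0 : ℝ) ≤ y ^ (m / 2 - 1) * Real.exp (-y) := by positivity
      have : ∀ t : ℝ, t ^ (q - 1) * (y ^ (m / 2 - 1) * Real.exp (-((1 + 2 * t) * y))) =
          (y ^ (m / 2 - 1) * Real.exp (-y)) * (t ^ (q - 1) * Real.exp (-((2 * y) * t))) := by
        intro t
        rw [show -((1 + 2 * t) * y) = -y + -((2 * y) * t) by ring, Real.exp_add]
        ring
      simp_rw [this, ENNReal.ofReal_mul h1]
      rw [lintegral_const_mul' _ _ ENNReal.ofReal_ne_top,
        lintegral_rpow_mul_exp_neg_mul_Ioi hq (by linarith), ← ENNReal.ofReal_mul h1,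
        ← ENNReal.ofReal_mul (by positivity)]
      congr 1
      rw [show m / 2 - q - 1 = (m / 2 - 1) - q by ring, Real.rpow_sub hy' _ q,
        show 1 / (2 * y) = (1 / 2) * y⁻¹ by field_simp,
        Real.mul_rpow (by norm_num) (by positivity), Real.inv_rpow hy'.le, one_mul]
      ring
    _ = _ := by
      rw [lintegral_const_mul' _ _ ENNReal.ofReal_ne_top,
        lintegral_rpow_mul_exp_neg_mul_Ioi (by linarith) one_pos, ← ENNReal.ofReal_mul (by positivity),
        ← ENNReal.ofReal_mul (by positivity), ← ENNReal.ofReal_mul (by positivity), invChiSqMoment]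
      congr 1
      simp only [div_one, Real.one_rpow]
      field_simp

theorem invChiSqMoment_one {m : ℝ} (hm : 2 < m) : invChiSqMoment m 1 = 1 / (m - 2) := by
  have h := Real.Gamma_add_one (s := m / 2 - 1) (by linarith)
  have hG := Real.Gamma_pos_of_pos (s := m / 2 - 1) (by linarith)
  rw [sub_add_cancel] at h
  have : m - 2 ≠ 0 := by linarith
  have : m / 2 - 1 ≠ 0 := by linarith
  rw [invChiSqMoment, h, Real.rpow_one]
  generalize Real.Gamma (m / 2 - 1) = g at hG
  have := hG.ne'
  field_simp

/-! ### The Gamma function estimate behind the constant 3 -/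

theorem log_three_gt : (1.015 : ℝ) < Real.log 3 := by
  rw [Real.lt_log_iff_exp_lt (by norm_num), show (1.015 : ℝ) = 1 + 0.015 by norm_num, Real.exp_add]
  have h1 := Real.exp_one_lt_d9
  have h2 : Real.exp 0.015 ≤ 1.016 := by
    have := Real.add_one_le_exp (-0.015 : ℝ)
    rw [Real.exp_neg] at this
    have hp := Real.exp_pos 0.015
    have h3 : Real.exp 0.015 * (Real.exp 0.015)⁻¹ = 1 := mul_inv_cancel₀ hp.ne'
    nlinarith
  nlinarith [Real.exp_pos 1, Real.exp_pos 0.015]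

/-- With v = √(1+1/x), sinh u ≥ u at u = log v gives log(1+1/x) ≤ v - 1/v = 1/√(x²+x). The exponent
is thus at most (x+1/2)/√(x²+x), which for x ≥ 5/2 stays below 1.015 < log 3. -/
theorem one_add_inv_rpow_le_three {x : ℝ} (hx : 5 / 2 ≤ x) :
    (1 + 1 / x) ^ (x + 1 / 2) ≤ 3 := by
  have hx0 : 0 < x := by linarith
  have hu : 0 < 1 + 1 / x := by positivity
  set v := √(1 + 1 / x) with hv
  have hv0 : 0 < v := Real.sqrt_pos.2 hu
  have hv2 : v ^ 2 = 1 + 1 / x := Real.sq_sqrt hu.le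
  have hv1 : 1 ≤ v := by
    rw [hv, Real.one_le_sqrt]
    simp [hx0.le]
  have hlog : Real.log (1 + 1 / x) ≤ v - v⁻¹ := by
    have h := Real.self_le_sinh_iff.2 (Real.log_nonneg hv1)
    rw [Real.sinh_log hv0] at h
    rw [← hv2, Real.log_pow]
    push_cast
    linarith
  have hkey : (x + 1 / 2) * (v - v⁻¹) ≤ 1.015 := by
    have h1 : v - v⁻¹ = 1 / (x * v) := by
      have : v - v⁻¹ = (v ^ 2 - 1) / v := by field_simp
      rw [this, hv2]
      field_simp
      ring
    rw [h1, mul_one_div, div_le_iff₀ (by positivity)]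
    refine le_of_sq_le_sq ?_ (by positivity)
    have : (1.015 * (x * v)) ^ 2 = 1.015 ^ 2 * (x ^ 2 + x) := by
      rw [mul_pow, mul_pow, hv2]
      field_simp
    rw [this]
    nlinarith
  rw [Real.rpow_def_of_pos hu, ← Real.le_log_iff_exp_le (by norm_num)]
  nlinarith [log_three_gt]

/-- Induction in steps of two. From r to r+2 the right side gains the factor x = (r+1)/2 and the
left side gains (1+1/x)^(x+1/2) · x/3, so the step needs exactly (1+1/x)^(x+1/2) ≤ 3. Since r ≥ 4, x
is at least 5/2; the base cases are 4 and 5. -/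
theorem sqrt_pi_mul_rpow_le_Gamma {p : ℕ} (hp : 4 ≤ p) :
    √Real.pi * (((p : ℝ) + 1) / 6) ^ ((p : ℝ) / 2) ≤ Real.Gamma (((p : ℝ) + 1) / 2) := by
  induction p using Nat.strong_induction_on with
  | _ p ih =>
    rcases Nat.lt_or_ge p 6 with h6 | h6
    · interval_cases p
      · have h := Real.Gamma_add_one (s := 3 / 2) (by norm_num)
        have h' := Real.Gamma_add_one (s := 1 / 2) (by norm_num)
        rw [Real.Gamma_one_half_eq] at h'
        norm_num at h h' ⊢
        rw [h, h']
        nlinarith [Real.sqrt_nonneg Real.pi]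
      · norm_num
        rw [Real.sqrt_le_left (by positivity)]
        linarith [Real.pi_lt_four]
    · obtain ⟨r, rfl⟩ := Nat.exists_eq_add_of_le' (show 2 ≤ p by omega)
      have hr4 : (4 : ℝ) ≤ r := by exact_mod_cast (by omega : 4 ≤ r)
      have hI := ih r (by omega) (by omega)
      have hG := Real.Gamma_add_one (s := ((r : ℝ) + 1) / 2) (by positivity)
      have h3 := one_add_inv_rpow_le_three (x := ((r : ℝ) + 1) / 2) (by linarith)
      push_cast
      rw [show ((r : ℝ) + 2 + 1) / 2 = ((r : ℝ) + 1) / 2 + 1 by ring, hG]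
      have he : ((r : ℝ) + 2) / 2 = ((r : ℝ) + 1) / 2 + 1 / 2 := by ring
      have hb : ((r : ℝ) + 2 + 1) / 6 =
          (1 + 1 / (((r : ℝ) + 1) / 2)) * (((r : ℝ) + 1) / 6) := by
        field_simp
        ring
      have hs : (((r : ℝ) + 1) / 6) ^ (((r : ℝ) + 2) / 2) =
          (((r : ℝ) + 1) / 6) ^ ((r : ℝ) / 2) * (((r : ℝ) + 1) / 6) := by
        rw [show ((r : ℝ) + 2) / 2 = (r : ℝ) / 2 + 1 by ring, Real.rpow_add_one (by positivity)]
      rw [hb, Real.mul_rpow (by positivity) (by positivity), hs, he]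
      calc _ = (1 + 1 / (((r : ℝ) + 1) / 2)) ^ (((r : ℝ) + 1) / 2 + 1 / 2) * ((((r : ℝ) + 1) / 6) *
            (√Real.pi * (((r : ℝ) + 1) / 6) ^ ((r : ℝ) / 2))) := by ring
        _ ≤ 3 * ((((r : ℝ) + 1) / 6) * Real.Gamma (((r : ℝ) + 1) / 2)) := by gcongr
        _ = _ := by ring

theorem invChiSqMoment_half_le {p : ℕ} (hp : 4 ≤ p) :
    invChiSqMoment ((p : ℝ) + 1) ((p : ℝ) / 2) ≤ (3 / ((p : ℝ) + 1)) ^ ((p : ℝ) / 2) := by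
  have h := sqrt_pi_mul_rpow_le_Gamma hp
  have hG : 0 < Real.Gamma (((p : ℝ) + 1) / 2) := Real.Gamma_pos_of_pos (by positivity)
  rw [invChiSqMoment, show ((p : ℝ) + 1) / 2 - (p : ℝ) / 2 = 1 / 2 by ring,
    Real.Gamma_one_half_eq, div_le_iff₀ hG]
  calc (1 / 2 : ℝ) ^ ((p : ℝ) / 2) * √Real.pi
      = (3 / ((p : ℝ) + 1)) ^ ((p : ℝ) / 2) *
        (√Real.pi * (((p : ℝ) + 1) / 6) ^ ((p : ℝ) / 2)) := by
        rw [mul_left_comm, ← Real.mul_rpow (by positivity) (by positivity), mul_comm]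
        congr 2
        field_simp
        norm_num
    _ ≤ _ := by gcongr

/-! ### Diagonal entries of the inverse Gram matrix -/

open Matrix in
/-- The inverse of the regularized Gram matrix of the rows of `G`. -/
noncomputable def gramInv {k ℓ : ℕ} (ε : ℝ) (G : Fin k → Fin ℓ → ℝ) : Matrix (Fin k) (Fin k) ℝ :=
  (Matrix.of G * (Matrix.of G)ᵀ + ε • 1)⁻¹

open Matrix in
theorem measurable_gramInv_apply {k ℓ : ℕ} (ε : ℝ) (i j : Fin k) :
    Measurable fun G : Fin k → Fin ℓ → ℝ => gramInv ε G i j := by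
  have hH : Continuous fun G : Fin k → Fin ℓ → ℝ =>
      Matrix.of G * (Matrix.of G)ᵀ + ε • (1 : Matrix (Fin k) (Fin k) ℝ) := by
    have : Continuous fun G : Fin k → Fin ℓ → ℝ => Matrix.of G := continuous_id
    exact (this.matrix_mul this.matrix_transpose).add continuous_const
  simp only [gramInv, Matrix.inv_def, Ring.inverse_eq_inv', Matrix.smul_apply, smul_eq_mul]
  exact (hH.matrix_det.measurable.inv).mul
    ((hH.matrix_adjugate.matrix_elem i j).measurable)

open Matrix in
theorem dotProduct_self_nonneg_real {ι : Type*} [Fintype ι] (x : ι → ℝ) : 0 ≤ x ⬝ᵥ x :=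
  Finset.sum_nonneg fun i _ => mul_self_nonneg (x i)

-- With H the regularized Gram matrix and x the i-th column of its inverse, Hx is a unit vector and
-- xᵀHx = x_i, which splits as ‖Gᵀx‖² + ε‖x‖².
open Matrix in
theorem gramInv_diag_bounds {k ℓ : ℕ} {ε : ℝ} (G : Fin k → Fin ℓ → ℝ)
    (hdet : IsUnit (Matrix.of G * (Matrix.of G)ᵀ + ε • (1 : Matrix (Fin k) (Fin k) ℝ)).det)
    (i : Fin k) (x : Fin k → ℝ) (hx : x = gramInv ε G *ᵥ Pi.single i 1) :
    x i = gramInv ε G i i ∧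
    (Matrix.of G * (Matrix.of G)ᵀ + ε • (1 : Matrix (Fin k) (Fin k) ℝ)) *ᵥ x = Pi.single i 1 ∧
    ((Matrix.of G)ᵀ *ᵥ x) ⬝ᵥ ((Matrix.of G)ᵀ *ᵥ x) + ε * (x ⬝ᵥ x) = gramInv ε G i i := by
  have h1 : x i = gramInv ε G i i := by simp [hx]
  have h2 : (Matrix.of G * (Matrix.of G)ᵀ + ε • (1 : Matrix (Fin k) (Fin k) ℝ)) *ᵥ x =
      Pi.single i 1 := by
    rw [hx, gramInv, Matrix.mulVec_mulVec, Matrix.mul_nonsing_inv _ hdet, Matrix.one_mulVec]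
  refine ⟨h1, h2, ?_⟩
  have h3 := congrArg (fun w => x ⬝ᵥ w) h2
  simp only [dotProduct_single, mul_one] at h3
  rw [← h1, ← h3, Matrix.add_mulVec, dotProduct_add, Matrix.smul_mulVec, Matrix.one_mulVec,
    dotProduct_smul, ← Matrix.mulVec_mulVec, Matrix.dotProduct_mulVec x, ← Matrix.mulVec_transpose]
  simp

open Matrix in
theorem gramInv_diag_nonneg {k ℓ : ℕ} {ε : ℝ} (hε : 0 ≤ ε) (G : Fin k → Fin ℓ → ℝ) (i : Fin k) :
    0 ≤ gramInv ε G i i := by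
  by_cases hdet : IsUnit (Matrix.of G * (Matrix.of G)ᵀ + ε • (1 : Matrix (Fin k) (Fin k) ℝ)).det
  · obtain ⟨-, -, h⟩ := gramInv_diag_bounds G hdet i _ rfl
    rw [← h]
    exact add_nonneg (dotProduct_self_nonneg_real _) (mul_nonneg hε (dotProduct_self_nonneg_real _))
  · simp [gramInv, Matrix.nonsing_inv_apply_not_isUnit _ hdet]

-- Pairing Gᵀx with y gives the diagonal entry M_ii because Gy is a unit vector; Cauchy–Schwarz then
-- yields M_ii² ≤ M_ii‖y‖². In the singular case the inverse is 0 by convention and the bound is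
-- trivial.
open Matrix in
theorem gramInv_diag_le {k ℓ : ℕ} {ε : ℝ} (hε : 0 ≤ ε) (G : Fin k → Fin ℓ → ℝ) (i : Fin k)
    {y : Fin ℓ → ℝ} (hy : Matrix.of G *ᵥ y = Pi.single i 1) :
    gramInv ε G i i ≤ y ⬝ᵥ y := by
  by_cases hdet : IsUnit (Matrix.of G * (Matrix.of G)ᵀ + ε • (1 : Matrix (Fin k) (Fin k) ℝ)).det
  · obtain ⟨h1, -, h3⟩ := gramInv_diag_bounds G hdet i _ rfl
    set x := gramInv ε G *ᵥ Pi.single i 1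
    have hzy : ((Matrix.of G)ᵀ *ᵥ x) ⬝ᵥ y = gramInv ε G i i := by
      rw [Matrix.mulVec_transpose, ← Matrix.dotProduct_mulVec, hy, ← h1]
      simp
    have hcs : (((Matrix.of G)ᵀ *ᵥ x) ⬝ᵥ y) ^ 2 ≤
        (((Matrix.of G)ᵀ *ᵥ x) ⬝ᵥ ((Matrix.of G)ᵀ *ᵥ x)) * (y ⬝ᵥ y) := by
      have := Finset.sum_mul_sq_le_sq_mul_sq Finset.univ ((Matrix.of G)ᵀ *ᵥ x) y
      simpa only [dotProduct, ← sq] using this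
    rw [hzy] at hcs
    have hxx := mul_nonneg hε (dotProduct_self_nonneg_real x)
    have hyy := dotProduct_self_nonneg_real y
    rcases (gramInv_diag_nonneg hε G i).eq_or_lt with h0 | h0
    · rw [← h0]; exact hyy
    · have : gramInv ε G i i ^ 2 ≤ gramInv ε G i i * (y ⬝ᵥ y) :=
        hcs.trans (mul_le_mul_of_nonneg_right (by linarith) hyy)
      exact le_of_mul_le_mul_left (by linarith [sq (gramInv ε G i i)]) h0
  · have : gramInv ε G i i = 0 := by simp [gramInv, Matrix.nonsing_inv_apply_not_isUnit _ hdet]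
    rw [this]
    exact dotProduct_self_nonneg_real y

theorem exists_orthonormalBasis_orthogonal {n ℓ : ℕ} (r : Fin n → EuclideanSpace ℝ (Fin ℓ)) :
    ∃ (b : OrthonormalBasis (Fin ℓ) ℝ (EuclideanSpace ℝ (Fin ℓ))) (S : Finset (Fin ℓ)),
      S.card = ℓ - n ∧ ∀ a ∈ S, ∀ j, inner ℝ (b a) (r j) = 0 := by
  classical
  set U := Submodule.span ℝ (Set.range r)
  have hU : Module.finrank ℝ U ≤ n := (finrank_range_le_card (R := ℝ) r).trans (by simp)
  have hUo := U.finrank_add_finrank_orthogonal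
  rw [finrank_euclideanSpace_fin] at hUo
  have hm : ℓ - n ≤ Module.finrank ℝ Uᗮ := by omega
  set u := stdOrthonormalBasis ℝ Uᗮ
  -- Only the first ℓ - n values matter; the zeros are placeholders that the extension to an
  -- orthonormal basis replaces.
  let v : Fin ℓ → EuclideanSpace ℝ (Fin ℓ) := fun a =>
    if h : (a : ℕ) < ℓ - n then u ⟨a, h.trans_le hm⟩ else 0
  let s : Set (Fin ℓ) := {a | (a : ℕ) < ℓ - n}
  have hv : Orthonormal ℝ (s.domRestrict v) := by
    have : s.domRestrict v = fun a : s => ((u ⟨a.1, a.2.trans_le hm⟩ : Uᗮ) : EuclideanSpace ℝ (Fin ℓ)) := by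
      ext1 a
      have : ((a : Fin ℓ) : ℕ) < ℓ - n := a.2
      simp [Set.domRestrict, v, this]
    rw [this]
    refine (u.orthonormal.comp (fun a : s => (⟨a.1, a.2.trans_le hm⟩ : Fin _)) ?_).comp_linearIsometry
      Uᗮ.subtypeₗᵢ
    intro a b hab
    simpa [Fin.ext_iff, Subtype.ext_iff] using hab
  obtain ⟨b, hb⟩ := hv.exists_orthonormalBasis_extension_of_card_eq (by simp)
  refine ⟨b, Finset.univ.filter (fun a : Fin ℓ => (a : ℕ) < ℓ - n), ?_, ?_⟩
  · rw [Fin.card_filter_val_lt]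
    omega
  · intro a ha j
    have ha' : (a : ℕ) < ℓ - n := by simpa using ha
    rw [hb a ha', real_inner_comm]
    simp only [v, ha', dif_pos]
    exact (u ⟨a, ha'.trans_le hm⟩).2 (r j) (Submodule.subset_span ⟨j, rfl⟩)

/-- Rotation invariance: the coordinates of a standard Gaussian vector in any orthonormal basis are
again independent standard Gaussians. -/
theorem lintegral_pi_gaussianReal_inner_rpow_neg_le {ℓ : ℕ}
    (b : OrthonormalBasis (Fin ℓ) ℝ (EuclideanSpace ℝ (Fin ℓ))) (S : Finset (Fin ℓ)) {q : ℝ}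
    (hq : 0 < q) (hqS : q < (S.card : ℝ) / 2) :
    ∫⁻ g, ENNReal.ofReal (∑ a ∈ S, (inner ℝ (b a) (WithLp.toLp 2 g)) ^ 2) ^ (-q)
        ∂Measure.pi (fun _ : Fin ℓ => gaussianReal 0 1) ≤
      ENNReal.ofReal (invChiSqMoment S.card q) := by
  have hΦ : Measurable fun v : EuclideanSpace ℝ (Fin ℓ) =>
      ENNReal.ofReal (∑ a ∈ S, (inner ℝ (b a) v) ^ 2) ^ (-q) := by fun_prop
  rw [← lintegral_map hΦ (by fun_prop), map_pi_eq_stdGaussian,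
    stdGaussian_eq_map_pi_orthonormalBasis b, lintegral_map hΦ (by fun_prop)]
  refine le_of_eq_of_le ?_ (lintegral_pi_gaussianReal_rpow_neg_le S hq hqS)
  simp_rw [inner_sum, inner_smul_right, b.inner_eq_ite]
  simp

-- Project row i onto the span of the `b a` with `a ∈ S` and divide by the squared length s of the
-- projection. The result y satisfies Gy = e_i and ‖y‖² = 1/s, so the variational bound applies. For
-- s = 0 the right side is infinite.
open Matrix in
theorem ofReal_gramInv_diag_rpow_le {k ℓ : ℕ} {ε : ℝ} (hε : 0 ≤ ε) (G : Fin k → Fin ℓ → ℝ)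
    (i : Fin k) (b : OrthonormalBasis (Fin ℓ) ℝ (EuclideanSpace ℝ (Fin ℓ))) (S : Finset (Fin ℓ))
    (hS : ∀ a ∈ S, ∀ j, j ≠ i → inner ℝ (b a) (WithLp.toLp 2 (G j)) = 0) {q : ℝ} (hq : 0 < q) :
    ENNReal.ofReal (gramInv ε G i i) ^ q ≤
      ENNReal.ofReal (∑ a ∈ S, (inner ℝ (b a) (WithLp.toLp 2 (G i))) ^ 2) ^ (-q) := by
  set c : Fin ℓ → ℝ := fun a => inner ℝ (b a) (WithLp.toLp 2 (G i)) with hc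
  set s := ∑ a ∈ S, c a ^ 2 with hs
  have hs0 : 0 ≤ s := Finset.sum_nonneg fun a _ => sq_nonneg _
  rcases hs0.eq_or_lt with h0 | h0
  · rw [← h0, ENNReal.ofReal_zero, ENNReal.zero_rpow_of_neg (by linarith)]
    exact le_top
  · set y : EuclideanSpace ℝ (Fin ℓ) := ∑ a ∈ S, (c a / s) • b a with hy
    have hyG : Matrix.of G *ᵥ y.ofLp = Pi.single i 1 := by
      ext j
      have h1 : (Matrix.of G *ᵥ y.ofLp) j = inner ℝ y (WithLp.toLp 2 (G j)) := by
        simp [Matrix.mulVec, dotProduct, PiLp.inner_apply]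
      rw [h1, hy, sum_inner]
      simp_rw [inner_smul_left]
      by_cases hj : j = i
      · subst hj
        have : ∑ a ∈ S, c a / s * c a = 1 := by
          have : ∀ a, c a / s * c a = c a ^ 2 / s := fun a => by ring
          simp_rw [this]
          rw [← Finset.sum_div, ← hs, div_self h0.ne']
        simpa [hc] using this
      · rw [Pi.single_eq_of_ne hj]
        exact Finset.sum_eq_zero fun a ha => by rw [hS a ha j hj, mul_zero]
    have hyy : y.ofLp ⬝ᵥ y.ofLp = s⁻¹ := by
      have h1 : y.ofLp ⬝ᵥ y.ofLp = inner ℝ y y := by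
        rw [PiLp.inner_apply]
        simp [dotProduct, sq]
      rw [h1, hy, b.orthonormal.inner_sum]
      have : ∀ a, (starRingEnd ℝ) (c a / s) * (c a / s) = c a ^ 2 / s ^ 2 := fun a => by
        simp; ring
      simp_rw [this]
      rw [← Finset.sum_div, ← hs]
      field_simp
    have h := gramInv_diag_le hε G i hyG
    rw [hyy] at h
    rw [ENNReal.rpow_neg, ← ENNReal.inv_rpow, ← ENNReal.ofReal_inv_of_pos h0]
    exact ENNReal.rpow_le_rpow (ENNReal.ofReal_le_ofReal h) hq.le

/-- The law of a matrix with independent standard Gaussian entries. -/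
noncomputable def gaussianMatrix (k ℓ : ℕ) : Measure (Fin k → Fin ℓ → ℝ) :=
  Measure.pi fun _ => Measure.pi fun _ => gaussianReal 0 1

instance (k ℓ : ℕ) : IsProbabilityMeasure (gaussianMatrix k ℓ) := by
  unfold gaussianMatrix; infer_instance

/-- Freeze all rows but row i. The basis orthogonal to them does not depend on row i, so along it
that row has ℓ - n independent Gaussian coordinates. The bound is uniform in ε, which the proof of
almost sure invertibility needs. -/
theorem lintegral_gramInv_rpow_le {n ℓ : ℕ} {ε q : ℝ} (hε : 0 ≤ ε) (hq : 0 < q)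
    (hqℓ : q < ((ℓ - n : ℕ) : ℝ) / 2) (i : Fin (n + 1)) :
    ∫⁻ G, ENNReal.ofReal (gramInv ε G i i) ^ q ∂gaussianMatrix (n + 1) ℓ ≤
      ENNReal.ofReal (invChiSqMoment (ℓ - n : ℕ) q) := by
  have hF : Measurable fun G : Fin (n + 1) → Fin ℓ → ℝ => ENNReal.ofReal (gramInv ε G i i) ^ q :=
    (measurable_gramInv_apply ε i i).ennreal_ofReal.pow_const q
  have hmp := (measurePreserving_piFinSuccAbove
    (fun _ : Fin (n + 1) => Measure.pi fun _ : Fin ℓ => gaussianReal 0 1) i).symm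
  refine (hmp.lintegral_comp hF).symm.trans_le ?_
  refine (lintegral_prod_symm _ (hF.comp (MeasurableEquiv.measurable _)).aemeasurable).trans_le ?_
  refine (lintegral_mono (g := fun _ => ENNReal.ofReal (invChiSqMoment (ℓ - n : ℕ) q))
    fun r => ?_).trans (by simp)
  obtain ⟨b, S, hcard, hS⟩ := exists_orthonormalBasis_orthogonal
    (fun j : Fin n => WithLp.toLp 2 (r j))
  have hI := lintegral_pi_gaussianReal_inner_rpow_neg_le b S hq (by rwa [hcard])
  rw [hcard] at hI
  refine (lintegral_mono fun g => ?_).trans hI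
  have := ofReal_gramInv_diag_rpow_le hε
    ((MeasurableEquiv.piFinSuccAbove (fun _ : Fin (n + 1) => Fin ℓ → ℝ) i).symm (g, r)) i b S
    (fun a ha j hj => by
      obtain ⟨j', rfl⟩ := Fin.exists_succAbove_eq hj
      simpa using hS a ha j') hq
  simpa using this

open Matrix in
theorem isUnit_det_regularized_gram {k ℓ : ℕ} {ε : ℝ} (hε : 0 < ε) (G : Fin k → Fin ℓ → ℝ) :
    IsUnit (Matrix.of G * (Matrix.of G)ᵀ + ε • (1 : Matrix (Fin k) (Fin k) ℝ)).det := by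
  have h1 : (Matrix.of G * (Matrix.of G)ᵀ).PosSemidef := by
    simpa using Matrix.posSemidef_self_mul_conjTranspose (Matrix.of G)
  have h2 : (ε • (1 : Matrix (Fin k) (Fin k) ℝ)).PosDef := Matrix.PosDef.one.smul hε
  exact (h2.posSemidef_add h1).det_pos.ne'.isUnit

-- A null vector w of GGᵀ is an eigenvector of the regularized matrix with eigenvalue ε. At the
-- index i maximizing |w_i|, w_i = ε⟨w, x⟩ for the i-th column x of the inverse. With ‖w‖² ≤ k w_i²,
-- Cauchy–Schwarz gives ‖x‖² ≥ 1/(ε²k), and the diagonal entry is at least ε‖x‖².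
open Matrix in
theorem exists_le_gramInv_diag {k ℓ : ℕ} {ε : ℝ} (hε : 0 < ε) (G : Fin k → Fin ℓ → ℝ)
    (h0 : (Matrix.of G * (Matrix.of G)ᵀ).det = 0) :
    ∃ i, 1 / (ε * k) ≤ gramInv ε G i i := by
  obtain ⟨w, hw0, hw⟩ := Matrix.exists_mulVec_eq_zero_iff.2 h0
  have hne : Nonempty (Fin k) := by
    by_contra h
    rw [not_nonempty_iff] at h
    exact hw0 (Subsingleton.elim _ _)
  obtain ⟨i, hi⟩ := Finite.exists_max fun i => |w i|
  have hwi : w i ≠ 0 := by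
    intro h
    refine hw0 (funext fun j => ?_)
    have := hi j
    rw [h, abs_zero] at this
    simpa using this
  have hdet := isUnit_det_regularized_gram hε G
  obtain ⟨h1, h2, h3⟩ := gramInv_diag_bounds G hdet i _ rfl
  set x := gramInv ε G *ᵥ Pi.single i 1
  set H := Matrix.of G * (Matrix.of G)ᵀ + ε • (1 : Matrix (Fin k) (Fin k) ℝ) with hH
  have hHw : H *ᵥ w = ε • w := by
    rw [hH, Matrix.add_mulVec, hw, Matrix.smul_mulVec, Matrix.one_mulVec, zero_add]
  have hHt : Hᵀ = H := by simp [hH, Matrix.transpose_mul]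
  have hwx : w i = ε * (w ⬝ᵥ x) := by
    have : w ⬝ᵥ (H *ᵥ x) = w i := by rw [h2]; simp
    rw [← this, Matrix.dotProduct_mulVec, ← Matrix.mulVec_transpose, hHt, hHw, smul_dotProduct,
      smul_eq_mul]
  have hww : w ⬝ᵥ w ≤ k * w i ^ 2 := by
    have : ∀ j ∈ Finset.univ, w j * w j ≤ w i ^ 2 := fun j _ => by
      rw [← sq]; exact sq_le_sq.2 (hi j)
    simpa [dotProduct] using Finset.sum_le_card_nsmul _ _ _ this
  have hcs : (w ⬝ᵥ x) ^ 2 ≤ (w ⬝ᵥ w) * (x ⬝ᵥ x) := by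
    have := Finset.sum_mul_sq_le_sq_mul_sq Finset.univ w x
    simpa only [dotProduct, ← sq] using this
  have hxx := dotProduct_self_nonneg_real x
  have hk : (0 : ℝ) < k := by
    have : 0 < k := Fin.pos i
    exact_mod_cast this
  have hwi2 : 0 < w i ^ 2 := by positivity
  refine ⟨i, ?_⟩
  have hz := dotProduct_self_nonneg_real ((Matrix.of G)ᵀ *ᵥ x)
  have hmain : w i ^ 2 ≤ w i ^ 2 * (ε ^ 2 * k * (x ⬝ᵥ x)) := by
    calc w i ^ 2 = ε ^ 2 * (w ⬝ᵥ x) ^ 2 := by rw [hwx]; ring_nf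
      _ ≤ ε ^ 2 * ((k * w i ^ 2) * (x ⬝ᵥ x)) := by gcongr; exact hcs.trans (by gcongr)
      _ = _ := by ring
  have hone : 1 ≤ ε ^ 2 * k * (x ⬝ᵥ x) := by
    by_contra hlt
    nlinarith
  rw [div_le_iff₀ (by positivity)]
  calc (1 : ℝ) ≤ (ε * (x ⬝ᵥ x)) * (ε * k) := by linarith
    _ ≤ gramInv ε G i i * (ε * k) := by gcongr; linarith

-- Singularity forces the trace of the regularized inverse to be at least of order 1/ε, while its
-- mean is bounded uniformly in ε. Markov gives probability O(ε), and ε tends to 0. Three spare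
-- dimensions make the first inverse moment finite.
open Matrix in
theorem ae_isUnit_det_gram {n ℓ : ℕ} (hℓ : n + 3 ≤ ℓ) :
    ∀ᵐ G ∂gaussianMatrix (n + 1) ℓ, IsUnit (Matrix.of G * (Matrix.of G)ᵀ).det := by
  have hq : (1 : ℝ) < ((ℓ - n : ℕ) : ℝ) / 2 := by
    have : ((3 : ℕ) : ℝ) ≤ ((ℓ - n : ℕ) : ℝ) := by exact_mod_cast (by omega : 3 ≤ ℓ - n)
    push_cast at this
    linarith
  set M := ENNReal.ofReal (invChiSqMoment (ℓ - n : ℕ) 1)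
  set Z := {G : Fin (n + 1) → Fin ℓ → ℝ | ¬ IsUnit (Matrix.of G * (Matrix.of G)ᵀ).det}
  change gaussianMatrix (n + 1) ℓ Z = 0
  have hbound : ∀ ε : ℝ, 0 < ε → gaussianMatrix (n + 1) ℓ Z ≤
      ENNReal.ofReal ε * ((n + 1 : ℕ) * ((n + 1 : ℕ) * M)) := by
    intro ε hε
    have hEp : 0 < 1 / (ε * ((n + 1 : ℕ) : ℝ)) := by positivity
    have hsub : Z ⊆ {G | ENNReal.ofReal (1 / (ε * ((n + 1 : ℕ) : ℝ))) ≤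
        ∑ i, ENNReal.ofReal (gramInv ε G i i)} := by
      intro G hG
      obtain ⟨i, hi⟩ := exists_le_gramInv_diag hε G (by simpa [Z] using hG)
      exact (ENNReal.ofReal_le_ofReal hi).trans
        (Finset.single_le_sum (f := fun i => ENNReal.ofReal (gramInv ε G i i))
          (fun _ _ => zero_le) (Finset.mem_univ i))
    have hmeas : ∀ i, Measurable fun G : Fin (n + 1) → Fin ℓ → ℝ =>
        ENNReal.ofReal (gramInv ε G i i) :=
      fun i => (measurable_gramInv_apply ε i i).ennreal_ofReal
    refine (measure_mono hsub).trans ((meas_ge_le_lintegral_div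
      (Finset.measurable_sum _ fun i _ => hmeas i).aemeasurable
      (by simpa using hEp) ENNReal.ofReal_ne_top).trans ?_)
    rw [lintegral_finsetSum _ fun i _ => hmeas i, one_div, ENNReal.ofReal_inv_of_pos (by positivity),
      div_eq_mul_inv, inv_inv, ENNReal.ofReal_mul hε.le, ENNReal.ofReal_natCast, mul_comm, mul_assoc]
    gcongr
    refine (Finset.sum_le_card_nsmul _ _ M fun i _ => ?_).trans (by simp)
    simpa using lintegral_gramInv_rpow_le hε.le one_pos hq i
  have hC : ((n + 1 : ℕ) * ((n + 1 : ℕ) * M) : ENNReal) ≠ ⊤ :=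
    ENNReal.mul_ne_top (by simp) (ENNReal.mul_ne_top (by simp) ENNReal.ofReal_ne_top)
  have hlim : Filter.Tendsto (fun ε : ℝ => ENNReal.ofReal ε * ((n + 1 : ℕ) * ((n + 1 : ℕ) * M)))
      (nhdsWithin 0 (Set.Ioi 0)) (nhds 0) := by
    have h1 : Filter.Tendsto (fun ε : ℝ => ENNReal.ofReal ε) (nhds 0) (nhds 0) := by
      simpa using (ENNReal.continuous_ofReal.tendsto 0)
    simpa using! ENNReal.Tendsto.mul_const (h1.mono_left nhdsWithin_le_nhds) (Or.inr hC)
  refine le_antisymm (ge_of_tendsto hlim ?_) zero_le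
  filter_upwards [self_mem_nhdsWithin] with ε hε using hbound ε hε

/-! ### Singular vectors and eigenvalue inequalities -/

section LinearAlgebra

open Matrix

theorem frobenius_norm_sq {m n : ℕ} (M : Matrix (Fin m) (Fin n) ℝ) :
    ‖M‖ ^ 2 = ∑ i, ∑ j, M i j ^ 2 := by
  have h : (0 : ℝ) ≤ ∑ i, ∑ j, M i j ^ 2 :=
    Finset.sum_nonneg fun i _ => Finset.sum_nonneg fun j _ => sq_nonneg _
  rw [Matrix.frobenius_norm_def]
  simp only [Real.norm_eq_abs, Real.rpow_ofNat, sq_abs]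
  rw [← Real.sqrt_eq_rpow, Real.sq_sqrt h]

theorem frobenius_norm_sq_eq_trace {m n : ℕ} (M : Matrix (Fin m) (Fin n) ℝ) :
    ‖M‖ ^ 2 = (M * Mᵀ).trace := by
  rw [frobenius_norm_sq]
  simp [Matrix.trace, Matrix.mul_apply, sq]

theorem frobenius_norm_sq_eq_sum_col {m n : ℕ} (M : Matrix (Fin m) (Fin n) ℝ) :
    ‖M‖ ^ 2 = ∑ j, ‖euclideanCol M j‖ ^ 2 := by
  rw [frobenius_norm_sq, Finset.sum_comm]
  simp [euclideanCol, EuclideanSpace.norm_sq_eq]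

theorem frobenius_norm_sq_mul_transpose {m n : ℕ} (M : Matrix (Fin m) (Fin n) ℝ)
    {Q : Matrix (Fin n) (Fin n) ℝ} (hQ : Qᵀ * Q = 1) : ‖M * Qᵀ‖ ^ 2 = ‖M‖ ^ 2 := by
  rw [frobenius_norm_sq_eq_trace, frobenius_norm_sq_eq_trace, Matrix.transpose_mul,
    Matrix.transpose_transpose, Matrix.mul_assoc, ← Matrix.mul_assoc Qᵀ, hQ, Matrix.one_mul]

/-- The matrix whose rows are the vectors of an orthonormal basis. -/
noncomputable def basisRows {n : ℕ}
    (b : OrthonormalBasis (Fin n) ℝ (EuclideanSpace ℝ (Fin n))) : Matrix (Fin n) (Fin n) ℝ :=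
  Matrix.of fun i => (b i).ofLp

theorem basisRows_mul_transpose {n : ℕ}
    (b : OrthonormalBasis (Fin n) ℝ (EuclideanSpace ℝ (Fin n))) :
    basisRows b * (basisRows b)ᵀ = 1 := by
  ext i j
  have : (basisRows b * (basisRows b)ᵀ) i j = inner ℝ (b j) (b i) := by
    rw [PiLp.inner_apply]
    simp [basisRows, Matrix.mul_apply]
  rw [this, b.inner_eq_ite, Matrix.one_apply]
  simp [eq_comm]

theorem transpose_mul_basisRows {n : ℕ}
    (b : OrthonormalBasis (Fin n) ℝ (EuclideanSpace ℝ (Fin n))) :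
    (basisRows b)ᵀ * basisRows b = 1 :=
  mul_eq_one_comm.1 (basisRows_mul_transpose b)

theorem exists_sortedEigenvalues_decomposition {n : ℕ} {K : Matrix (Fin n) (Fin n) ℝ}
    (hK : K.IsHermitian) :
    ∃ E : Matrix (Fin n) (Fin n) ℝ, E * Eᵀ = 1 ∧ Eᵀ * E = 1 ∧
      K = Eᵀ * Matrix.diagonal (sortedEigenvalues hK) * E := by
  set b := ((isSymmetric_toEuclideanLin_iff.mpr hK).eigenvectorBasis
    finrank_euclideanSpace).reindex (finCongr (Fintype.card_fin n))
  have hb : ∀ j, K *ᵥ (b j).ofLp = sortedEigenvalues hK j • (b j).ofLp := by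
    intro j
    have := (isSymmetric_toEuclideanLin_iff.mpr hK).apply_eigenvectorBasis
      finrank_euclideanSpace (Fin.cast (Fintype.card_fin n).symm j)
    have h2 := congrArg WithLp.ofLp this
    have e : b j = (isSymmetric_toEuclideanLin_iff.mpr hK).eigenvectorBasis finrank_euclideanSpace
        (Fin.cast (Fintype.card_fin n).symm j) := by
      rw [OrthonormalBasis.reindex_apply]
      rfl
    rw [e]
    exact h2
  refine ⟨basisRows b, basisRows_mul_transpose b, transpose_mul_basisRows b, ?_⟩
  have hKE : K * (basisRows b)ᵀ = (basisRows b)ᵀ * Matrix.diagonal (sortedEigenvalues hK) := by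
    ext i j
    have h := congrFun (hb j) i
    simp only [Matrix.mul_diagonal, Matrix.transpose_apply, basisRows, Matrix.of_apply]
    rw [Matrix.mul_apply]
    simpa [Matrix.mulVec, dotProduct, mul_comm] using h
  rw [← hKE, Matrix.mul_assoc, transpose_mul_basisRows, Matrix.mul_one]

theorem sortedEigenvalues_pos {n : ℕ} {K : Matrix (Fin n) (Fin n) ℝ} (hK : K.PosDef) (j : Fin n) :
    0 < sortedEigenvalues hK.isHermitian j := by
  have := hK.eigenvalues_pos
    (Fintype.equivOfCardEq (Fintype.card_fin _) (Fin.cast (Fintype.card_fin n).symm j))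
  simpa [Matrix.IsHermitian.eigenvalues, sortedEigenvalues] using this

theorem mulVec_basis_norm_sq {m n : ℕ} (A : Matrix (Fin m) (Fin n) ℝ) (i : Fin n) :
    ‖toEuclideanLin A ((toEuclideanLin A).isSymmetric_adjoint_comp_self.eigenvectorBasis
      finrank_euclideanSpace_fin i)‖ ^ 2 = singularValue A i ^ 2 := by
  set T := toEuclideanLin A
  have h := T.isSymmetric_adjoint_comp_self.apply_eigenvectorBasis finrank_euclideanSpace_fin i
  set b := T.isSymmetric_adjoint_comp_self.eigenvectorBasis finrank_euclideanSpace_fin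
  rw [singularValue, T.sq_singularValues_fin finrank_euclideanSpace_fin i,
    ← real_inner_self_eq_norm_sq, ← LinearMap.adjoint_inner_right, ← LinearMap.comp_apply, h,
    inner_smul_right, real_inner_self_eq_norm_sq, b.norm_eq_one]
  simp

/-- `V` consists of the first k eigenvectors of AᵀA. In the full eigenbasis the residual loses its
first k columns and keeps the others, whose norms are the singular values. -/
theorem exists_dominant_right_singular_rows {n₁ n₂ k : ℕ} (hkn : k ≤ n₁)
    (A : Matrix (Fin n₂) (Fin n₁) ℝ) :
    ∃ V : Matrix (Fin k) (Fin n₁) ℝ, V * Vᵀ = 1 ∧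
      ‖A - A * Vᵀ * V‖ ^ 2 = ∑' j : ℕ, singularValue A (k + j) ^ 2 := by
  set b := (toEuclideanLin A).isSymmetric_adjoint_comp_self.eigenvectorBasis
      (finrank_euclideanSpace_fin (n := n₁) (𝕜 := ℝ)) with hb
  set Q := basisRows b
  have hQ := basisRows_mul_transpose b
  set V : Matrix (Fin k) (Fin n₁) ℝ := Q.submatrix (Fin.castLE hkn) id
  have hVQ : ∀ i j, (V * Qᵀ) i j = if Fin.castLE hkn i = j then 1 else 0 := by
    intro i j
    have := congrFun (congrFun hQ (Fin.castLE hkn i)) j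
    rw [Matrix.one_apply] at this
    exact this
  have hcol : ∀ i, ∑ r, (A * Qᵀ) r i ^ 2 = singularValue A i ^ 2 := by
    intro i
    rw [← mulVec_basis_norm_sq A i, EuclideanSpace.norm_sq_eq]
    refine Finset.sum_congr rfl fun r _ => ?_
    simp [Matrix.mul_apply, Matrix.mulVec, dotProduct, Q, basisRows, hb]
  have hent : ∀ r i, ((A - A * Vᵀ * V) * Qᵀ) r i =
      if k ≤ (i : ℕ) then (A * Qᵀ) r i else 0 := by
    intro r i
    have h1 : (A * Vᵀ * V) * Qᵀ = A * Vᵀ * (V * Qᵀ) := Matrix.mul_assoc _ _ _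
    rw [Matrix.sub_mul, Matrix.sub_apply, h1, Matrix.mul_apply (M := A * Vᵀ)]
    simp_rw [hVQ]
    split_ifs with hi
    · rw [Finset.sum_eq_zero, sub_zero]
      intro c _
      rw [if_neg, mul_zero]
      intro hc
      have := c.2
      simp [← hc] at hi
      omega
    · push Not at hi
      rw [Finset.sum_eq_single ⟨i, hi⟩]
      · have : Fin.castLE hkn ⟨i, hi⟩ = i := rfl
        rw [if_pos this, mul_one, sub_eq_zero]
        rfl
      · intro c _ hc
        rw [if_neg, mul_zero]
        rintro rfl
        exact hc rfl
      · simp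
  refine ⟨V, ?_, ?_⟩
  · ext i j
    have := congrFun (congrFun hQ (Fin.castLE hkn i)) (Fin.castLE hkn j)
    rw [Matrix.one_apply] at this ⊢
    simp only [Fin.castLE_inj] at this
    exact this
  · rw [← frobenius_norm_sq_mul_transpose _ (transpose_mul_basisRows b), frobenius_norm_sq,
      Finset.sum_comm]
    have h1 : ∀ i, ∑ r, ((A - A * Vᵀ * V) * Qᵀ) r i ^ 2 =
        if k ≤ (i : ℕ) then singularValue A i ^ 2 else 0 := by
      intro i
      simp_rw [hent]
      split_ifs
      · exact hcol i
      · simp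
    rw [Finset.sum_congr rfl fun i _ => h1 i,
      Fin.sum_univ_eq_sum_range (fun i => if k ≤ i then singularValue A i ^ 2 else 0) n₁,
      -- The infinite tail is finite: singular values with index at least n₁ vanish.
      tsum_eq_sum (s := Finset.range (n₁ - k))]
    · obtain ⟨d, rfl⟩ := Nat.exists_eq_add_of_le hkn
      rw [Finset.sum_range_add, Finset.sum_eq_zero, zero_add]
      · simp
      · intro i hi
        rw [if_neg]
        simpa using hi
    · intro j hj
      rw [singularValue, LinearMap.singularValues_of_finrank_le]
      · simp
      · simp at hj ⊢
        omega

/-- Rotating the rows by an eigenbasis of VKVᵀ leaves the projection VᵀV, hence the residual of A,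
unchanged. -/
theorem exists_rows_diagonalizing {n k : ℕ} {V : Matrix (Fin k) (Fin n) ℝ} (hV : V * Vᵀ = 1)
    {K : Matrix (Fin n) (Fin n) ℝ} (hK : K.IsHermitian) :
    ∃ (V' : Matrix (Fin k) (Fin n) ℝ) (d : Fin k → ℝ), V' * V'ᵀ = 1 ∧ V'ᵀ * V' = Vᵀ * V ∧
      V' * K * V'ᵀ = Matrix.diagonal d := by
  have hC : (V * K * Vᵀ).IsHermitian := by
    simpa using Matrix.isHermitian_mul_mul_conjTranspose V hK
  obtain ⟨E, h1, h2, h3⟩ := exists_sortedEigenvalues_decomposition hC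
  refine ⟨E * V, sortedEigenvalues hC, ?_, ?_, ?_⟩
  · rw [Matrix.transpose_mul, Matrix.mul_assoc, ← Matrix.mul_assoc V, hV, Matrix.one_mul, h1]
  · rw [Matrix.transpose_mul, Matrix.mul_assoc, ← Matrix.mul_assoc Eᵀ, h2, Matrix.one_mul]
  · have : E * V * K * (E * V)ᵀ = E * (V * K * Vᵀ) * Eᵀ := by
      simp only [Matrix.transpose_mul, Matrix.mul_assoc]
    rw [this]
    generalize sortedEigenvalues hC = w at h3
    rw [h3]
    calc _ = (E * Eᵀ) * Matrix.diagonal w * (E * Eᵀ) := by simp only [Matrix.mul_assoc]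
      _ = _ := by rw [h1]; simp

theorem trace_mul_mul_transpose_le {n m : ℕ} {K : Matrix (Fin n) (Fin n) ℝ} (hK : K.PosDef)
    (B : Matrix (Fin m) (Fin n) ℝ) (hn : 0 < n) :
    (B * K * Bᵀ).trace ≤ sortedEigenvalues hK.isHermitian ⟨0, hn⟩ * ‖B‖ ^ 2 := by
  obtain ⟨E, h1, h2, h3⟩ := exists_sortedEigenvalues_decomposition hK.isHermitian
  have hanti := sortedEigenvalues_antitone hK.isHermitian
  set w := sortedEigenvalues hK.isHermitian
  have ht : (B * K * Bᵀ).trace = ∑ r, ∑ j, w j * (B * Eᵀ) r j ^ 2 := by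
    have : B * K * Bᵀ = (B * Eᵀ) * Matrix.diagonal w * (B * Eᵀ)ᵀ := by
      rw [h3]
      simp only [Matrix.transpose_mul, Matrix.mul_assoc, Matrix.transpose_transpose]
    rw [this]
    generalize B * Eᵀ = S
    refine Finset.sum_congr rfl fun r _ => ?_
    rw [Matrix.diag_apply, Matrix.mul_apply]
    exact Finset.sum_congr rfl fun j _ => by
      rw [Matrix.mul_diagonal, Matrix.transpose_apply]; ring
  rw [ht, ← frobenius_norm_sq_mul_transpose B h2, frobenius_norm_sq, Finset.mul_sum]
  refine Finset.sum_le_sum fun r _ => ?_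
  rw [Finset.mul_sum]
  exact Finset.sum_le_sum fun j _ => mul_le_mul_of_nonneg_right
    (hanti (Fin.mk_le_of_le_val (Nat.zero_le _))) (sq_nonneg _)

theorem diag_pos_of_rows {n k : ℕ} {K : Matrix (Fin n) (Fin n) ℝ} (hK : K.PosDef)
    {V : Matrix (Fin k) (Fin n) ℝ} (hV : V * Vᵀ = 1) {d : Fin k → ℝ}
    (hd : V * K * Vᵀ = Matrix.diagonal d) (i : Fin k) : 0 < d i := by
  have hP : (V * K * Vᵀ).PosDef := by
    have hinj : Function.Injective fun v => v ᵥ* V := by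
      intro v w hvw
      have := congrArg (fun u => u ᵥ* Vᵀ) hvw
      simpa [Matrix.vecMul_vecMul, hV] using this
    simpa using hK.mul_mul_conjTranspose_same hinj
  rw [hd] at hP
  simpa using Matrix.posDef_diagonal_iff.1 hP i

/-- Each d_i is an average of eigenvalues with weights R_ij², so convexity of 1/x bounds 1/d_i by
the same average of the 1/w_j. The column totals c_j lie in [0,1] and add up to k, so the sum of the
c_j/w_j is at most the sum of the k largest 1/w_j. -/
theorem sum_inv_diag_le {n k : ℕ} (hk : 1 ≤ k) (hkn : k ≤ n) {K : Matrix (Fin n) (Fin n) ℝ}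
    (hK : K.PosDef) {V : Matrix (Fin k) (Fin n) ℝ} (hV : V * Vᵀ = 1) {d : Fin k → ℝ}
    (hd : V * K * Vᵀ = Matrix.diagonal d) :
    ∑ i, 1 / d i ≤ ∑ j : Fin n with n - k ≤ j.val, 1 / sortedEigenvalues hK.isHermitian j := by
  have hdpos := diag_pos_of_rows hK hV hd
  obtain ⟨E, h1, h2, h3⟩ := exists_sortedEigenvalues_decomposition hK.isHermitian
  have hanti := sortedEigenvalues_antitone hK.isHermitian
  have hpos := sortedEigenvalues_pos hK
  set w := sortedEigenvalues hK.isHermitian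
  set R := V * Eᵀ with hR
  have hRR : R * Rᵀ = 1 := by
    rw [hR, Matrix.transpose_mul, Matrix.transpose_transpose, Matrix.mul_assoc,
      ← Matrix.mul_assoc Eᵀ, h2, Matrix.one_mul, hV]
  have hrow : ∀ i, ∑ j, R i j ^ 2 = 1 := fun i => by
    have := congrFun (congrFun hRR i) i
    simpa [Matrix.mul_apply, sq] using this
  have hdi : ∀ i, d i = ∑ j, w j * R i j ^ 2 := by
    intro i
    have : V * K * Vᵀ = R * Matrix.diagonal w * Rᵀ := by
      rw [h3, hR]
      simp only [Matrix.transpose_mul, Matrix.mul_assoc, Matrix.transpose_transpose]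
    rw [hd] at this
    have := congrFun (congrFun this i) i
    rw [Matrix.diagonal_apply_eq, Matrix.mul_apply] at this
    rw [this]
    exact Finset.sum_congr rfl fun j _ => by
      rw [Matrix.mul_diagonal, Matrix.transpose_apply]; ring
  set c : Fin n → ℝ := fun j => ∑ i, R i j ^ 2 with hc
  have hc0 : ∀ j, 0 ≤ c j := fun j => Finset.sum_nonneg fun i _ => sq_nonneg _
  -- RᵀR is an orthogonal projection, so its diagonal entry c_j dominates its own square.
  have hc1 : ∀ j, c j ≤ 1 := by
    intro j
    have hP : (Rᵀ * R) * (Rᵀ * R) = Rᵀ * R := by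
      rw [Matrix.mul_assoc, ← Matrix.mul_assoc R, hRR, Matrix.one_mul]
    have hcj : c j = (Rᵀ * R) j j := by simp [hc, Matrix.mul_apply, sq]
    have hsym : ∀ l, (Rᵀ * R) l j = (Rᵀ * R) j l := fun l => by
      simp [Matrix.mul_apply, mul_comm]
    have h := congrFun (congrFun hP j) j
    rw [Matrix.mul_apply] at h
    simp_rw [hsym, ← sq] at h
    have hle := Finset.single_le_sum (f := fun l => (Rᵀ * R) j l ^ 2)
      (fun l _ => sq_nonneg _) (Finset.mem_univ j)
    simp only [h, ← hcj] at hle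
    nlinarith [hc0 j]
  have hcsum : ∑ j, c j = k := by
    rw [hc, Finset.sum_comm]
    simp [hrow]
  have hinv : ∀ i, 1 / d i ≤ ∑ j, R i j ^ 2 / w j := by
    intro i
    rw [div_le_iff₀ (hdpos i)]
    have := Finset.sum_mul_sq_le_sq_mul_sq Finset.univ (fun j => R i j / √(w j))
      (fun j => √(w j) * R i j)
    have e1 : ∀ j, R i j / √(w j) * (√(w j) * R i j) = R i j ^ 2 := fun j => by
      have : √(w j) ≠ 0 := (Real.sqrt_pos.2 (hpos j)).ne'
      field_simp
    simp only [e1, hrow, div_pow, mul_pow, Real.sq_sqrt (hpos _).le, ← hdi, one_pow] at this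
    exact this
  have hstep : ∑ i, 1 / d i ≤ ∑ j, c j / w j := by
    refine (Finset.sum_le_sum fun i _ => hinv i).trans (le_of_eq ?_)
    rw [Finset.sum_comm]
    exact Finset.sum_congr rfl fun j _ => by rw [hc, Finset.sum_div]
  refine hstep.trans ?_
  -- The zero-based index n - k starts the last k eigenvalues. Subtracting the threshold μ from
  -- every 1/w_j fixes the signs, so c_j can be replaced termwise by 1 or 0; the total shift is μk
  -- on both sides.
  set j₀ : Fin n := ⟨n - k, by omega⟩
  set μ := 1 / w j₀
  have hcard : (Finset.univ.filter fun j : Fin n => n - k ≤ j.val).card = k := by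
    have h := Fin.card_filter_val_lt (n := n) (m := n - k)
    have h' := Finset.card_filter_add_card_filter_not (s := (Finset.univ : Finset (Fin n)))
      (fun j : Fin n => (j : ℕ) < n - k)
    simp only [not_lt, Finset.card_univ, Fintype.card_fin] at h'
    omega
  have hterm : ∀ j, c j / w j - μ * c j ≤
      if n - k ≤ j.val then 1 / w j - μ else 0 := by
    intro j
    have e : c j / w j - μ * c j = c j * (1 / w j - μ) := by ring
    rw [e]
    split_ifs with hj
    · have : μ ≤ 1 / w j := one_div_le_one_div_of_le (hpos j) (hanti hj)
      nlinarith [hc1 j]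
    · have : 1 / w j ≤ μ := one_div_le_one_div_of_le (hpos j₀)
        (hanti (show j.val ≤ n - k by omega))
      nlinarith [hc0 j]
  have hsum := Finset.sum_le_sum fun j (_ : j ∈ Finset.univ) => hterm j
  rw [Finset.sum_sub_distrib, ← Finset.mul_sum, hcsum, ← Finset.sum_filter,
    Finset.sum_sub_distrib, Finset.sum_const, hcard, nsmul_eq_mul] at hsum
  linarith

end LinearAlgebra

/-! ### Deterministic error bound and whitening -/

section Projection

open Matrix

theorem euclideanCol_mul_mem {m n l : ℕ} (Y : Matrix (Fin m) (Fin n) ℝ)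
    (X : Matrix (Fin n) (Fin l) ℝ) (j : Fin l) : euclideanCol (Y * X) j ∈ columnSpace Y := by
  have : euclideanCol (Y * X) j = ∑ i, X i j • euclideanCol Y i := by
    ext r
    simp [euclideanCol, Matrix.mul_apply, mul_comm]
  rw [this]
  exact Submodule.sum_mem _ fun i _ => Submodule.smul_mem _ _ (Submodule.subset_span ⟨i, rfl⟩)

theorem euclideanCol_columnProjection_mul {m n l : ℕ} (Y : Matrix (Fin m) (Fin n) ℝ)
    (A : Matrix (Fin m) (Fin l) ℝ) (j : Fin l) :
    euclideanCol (columnProjection Y * A) j =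
      (columnSpace Y).starProjection (euclideanCol A j) := by
  have h : (columnSpace Y).starProjection = toEuclideanCLM (n := Fin m) (𝕜 := ℝ)
      (columnProjection Y) := by simp [columnProjection]
  rw [h]
  rfl

theorem euclideanCol_sub {m n : ℕ} (A B : Matrix (Fin m) (Fin n) ℝ) (j : Fin n) :
    euclideanCol (A - B) j = euclideanCol A j - euclideanCol B j := rfl

theorem norm_sub_columnProjection_mul_le {m n l : ℕ} (Y : Matrix (Fin m) (Fin n) ℝ)
    (A : Matrix (Fin m) (Fin l) ℝ) (X : Matrix (Fin n) (Fin l) ℝ) :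
    ‖A - columnProjection Y * A‖ ≤ ‖A - Y * X‖ := by
  refine le_of_sq_le_sq ?_ (norm_nonneg _)
  rw [frobenius_norm_sq_eq_sum_col, frobenius_norm_sq_eq_sum_col]
  refine Finset.sum_le_sum fun j _ => pow_le_pow_left₀ (norm_nonneg _) ?_ 2
  rw [euclideanCol_sub, euclideanCol_sub, euclideanCol_columnProjection_mul,
    Submodule.starProjection_minimal]
  exact ciInf_le (f := fun x : columnSpace Y => ‖euclideanCol A j - x‖)
    ⟨0, by rintro _ ⟨x, rfl⟩; exact norm_nonneg _⟩ ⟨_, euclideanCol_mul_mem Y X j⟩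

theorem exists_columnProjection_mul_eq {m n l : ℕ} (Y : Matrix (Fin m) (Fin n) ℝ)
    (A : Matrix (Fin m) (Fin l) ℝ) :
    ∃ X : Matrix (Fin n) (Fin l) ℝ, columnProjection Y * A = Y * X := by
  have h : ∀ j, ∃ x : Fin n → ℝ, ∑ i, x i • euclideanCol Y i =
      (columnSpace Y).starProjection (euclideanCol A j) := fun j => by
    have := Submodule.starProjection_apply_mem (columnSpace Y) (euclideanCol A j)
    rwa [columnSpace, Submodule.mem_span_range_iff_exists_fun] at this
  choose x hx using h
  refine ⟨Matrix.of fun i j => x j i, ?_⟩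
  ext r j
  have h1 := congrArg (fun v : EuclideanSpace ℝ (Fin m) => v r)
    ((euclideanCol_columnProjection_mul Y A j).trans (hx j).symm)
  simpa [euclideanCol, Matrix.mul_apply (M := Y), mul_comm] using! h1

theorem norm_sub_columnProjection_mul_le_norm {m n l : ℕ} (Y : Matrix (Fin m) (Fin n) ℝ)
    (A : Matrix (Fin m) (Fin l) ℝ) : ‖A - columnProjection Y * A‖ ≤ ‖A‖ := by
  simpa using norm_sub_columnProjection_mul_le Y A 0

/-- The projection jumps where the rank of Y changes, but the residual norm is the minimum over X of
the continuous functions ‖A - YX‖, and a countable dense set of X suffices. -/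
theorem measurable_norm_sub_columnProjection_mul {m n l : ℕ} (A : Matrix (Fin m) (Fin l) ℝ) :
    Measurable fun Y : Fin m → Fin n → ℝ => ‖A - columnProjection (Matrix.of Y) * A‖ := by
  obtain ⟨S, hSc, hSd⟩ := TopologicalSpace.exists_countable_dense (Fin n → Fin l → ℝ)
  have : Countable S := hSc
  have heq : ∀ Y : Fin m → Fin n → ℝ, ‖A - columnProjection (Matrix.of Y) * A‖ =
      ⨅ X : S, ‖A - Matrix.of Y * Matrix.of X.1‖ := by
    intro Y
    have hcont : Continuous fun X : Fin n → Fin l → ℝ => ‖A - Matrix.of Y * Matrix.of X‖ := by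
      have h1 : Continuous fun X : Fin n → Fin l → ℝ => Matrix.of X := continuous_id
      exact (continuous_const.sub (continuous_const.matrix_mul h1)).norm
    rw [hSd.ciInf' hcont]
    refine le_antisymm (le_ciInf fun X => norm_sub_columnProjection_mul_le _ _ _) ?_
    obtain ⟨X, hX⟩ := exists_columnProjection_mul_eq (Matrix.of Y) A
    rw [hX]
    exact ciInf_le (f := fun X : Fin n → Fin l → ℝ => ‖A - Matrix.of Y * Matrix.of X‖)
      ⟨0, by rintro _ ⟨x, rfl⟩; exact norm_nonneg _⟩ X
  simp_rw [heq]
  refine Measurable.iInf fun X => Continuous.measurable ?_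
  have h1 : Continuous fun Y : Fin m → Fin n → ℝ => Matrix.of Y := continuous_id
  exact (continuous_const.sub (h1.matrix_mul continuous_const)).norm

theorem norm_sub_columnProjection_mul_le_add {n₁ n₂ k ℓ : ℕ} (A : Matrix (Fin n₂) (Fin n₁) ℝ)
    {V : Matrix (Fin k) (Fin n₁) ℝ} (hV : V * Vᵀ = 1) {d : Fin k → ℝ} (hd : ∀ i, 0 < d i)
    (Ω : Matrix (Fin n₁) (Fin ℓ) ℝ) (G : Fin k → Fin ℓ → ℝ)
    (hG : Matrix.of G = Matrix.diagonal (fun i => 1 / √(d i)) * V * Ω)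
    (hdet : IsUnit (Matrix.of G * (Matrix.of G)ᵀ).det) :
    ‖A - columnProjection (A * Ω) * A‖ ≤ ‖A - A * Vᵀ * V‖ +
      ‖(A - A * Vᵀ * V) * Ω‖ * √(∑ i, 1 / d i * gramInv 0 G i i) := by
  set Δ : Matrix (Fin k) (Fin k) ℝ := Matrix.diagonal (fun i => 1 / √(d i)) with hΔ
  set M := gramInv 0 G with hM
  have hMdef : M = (Matrix.of G * (Matrix.of G)ᵀ)⁻¹ := by rw [hM, gramInv, zero_smul, add_zero]
  have hMr : Matrix.of G * (Matrix.of G)ᵀ * M = 1 := by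
    rw [hMdef, Matrix.mul_nonsing_inv _ hdet]
  have hMt : Mᵀ = M := by
    rw [hMdef, Matrix.transpose_nonsing_inv, Matrix.transpose_mul, Matrix.transpose_transpose]
  have hΔi : Matrix.diagonal (fun i => √(d i)) * Δ = 1 := by
    rw [hΔ, Matrix.diagonal_mul_diagonal, ← Matrix.diagonal_one]
    congr 1
    ext i
    have : √(d i) ≠ 0 := (Real.sqrt_pos.2 (hd i)).ne'
    field_simp
  have hVΩ : V * Ω = Matrix.diagonal (fun i => √(d i)) * Matrix.of G := by
    rw [hG, ← Matrix.mul_assoc, ← Matrix.mul_assoc, hΔi, Matrix.one_mul]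
  -- Since VΩ = diag(√d) G, the product GᵀMΔ is a right inverse of VΩ, so X reproduces V exactly.
  set X := (Matrix.of G)ᵀ * M * Δ * V with hX
  have hVX : V * Ω * X = V := by
    calc V * Ω * X = Matrix.diagonal (fun i => √(d i)) *
          (Matrix.of G * (Matrix.of G)ᵀ * M) * Δ * V := by
          rw [hVΩ, hX]; simp only [Matrix.mul_assoc]
      _ = V := by rw [hMr, Matrix.mul_one, hΔi, Matrix.one_mul]
  set B := A - A * Vᵀ * V with hB
  have hdecomp : A - A * Ω * X = B - B * Ω * X := by
    have : A * Vᵀ * V * Ω * X = A * Vᵀ * V := by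
      calc A * Vᵀ * V * Ω * X = A * Vᵀ * (V * Ω * X) := by simp only [Matrix.mul_assoc]
        _ = _ := by rw [hVX]
    rw [hB, Matrix.sub_mul, Matrix.sub_mul, this]
    abel
  have hXnorm : ‖X‖ ^ 2 = ∑ i, 1 / d i * M i i := by
    have h1 : ‖X‖ ^ 2 = (Δ * M * Δ).trace := by
      rw [← Matrix.frobenius_norm_transpose, frobenius_norm_sq_eq_trace, Matrix.transpose_transpose]
      calc (Xᵀ * X).trace
          = ((Vᵀ * (Δ * M)) * ((Matrix.of G * (Matrix.of G)ᵀ * M) * (Δ * V))).trace := by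
            rw [hX]
            simp only [Matrix.transpose_mul, hMt, Matrix.transpose_transpose, Matrix.mul_assoc,
              hΔ, Matrix.diagonal_transpose]
        _ = ((Δ * M * Δ) * (V * Vᵀ)).trace := by
            rw [hMr, Matrix.one_mul, Matrix.mul_assoc Vᵀ, Matrix.trace_mul_comm]
            simp only [Matrix.mul_assoc]
        _ = _ := by rw [hV, Matrix.mul_one]
    rw [h1]
    refine Finset.sum_congr rfl fun i _ => ?_
    rw [Matrix.diag_apply, hΔ, Matrix.mul_diagonal, Matrix.diagonal_mul]
    have : 1 / √(d i) * (1 / √(d i)) = 1 / d i := by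
      rw [one_div_mul_one_div, Real.mul_self_sqrt (hd i).le]
    rw [mul_right_comm, this]
  calc ‖A - columnProjection (A * Ω) * A‖ ≤ ‖A - A * Ω * X‖ :=
        norm_sub_columnProjection_mul_le _ _ _
    _ = ‖B - B * Ω * X‖ := by rw [hdecomp]
    _ ≤ ‖B‖ + ‖B * Ω * X‖ := norm_sub_le _ _
    _ ≤ ‖B‖ + ‖B * Ω‖ * ‖X‖ := by gcongr; exact Matrix.frobenius_norm_mul _ _
    _ = _ := by rw [← hXnorm, Real.sqrt_sq (norm_nonneg _)]

/-- Factor K = ZZᵀ and let the orthogonal E diagonalize (BZ)ᵀ(BZ); the matrix EZ⁻¹ then whitens K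
and diagonalizes BᵀB at once. It turns ‖BΩ‖² into a weighted sum of squares of independent
Gaussians. -/
theorem exists_whitening {n m : ℕ} {K : Matrix (Fin n) (Fin n) ℝ} (hK : K.PosDef)
    (B : Matrix (Fin m) (Fin n) ℝ) :
    ∃ (W : Matrix (Fin n) (Fin n) ℝ) (a : Fin n → ℝ), W * K * Wᵀ = 1 ∧ (∀ i, 0 ≤ a i) ∧
      ∑ i, a i = (B * K * Bᵀ).trace ∧ Bᵀ * B = Wᵀ * Matrix.diagonal a * W := by
  obtain ⟨F, hF1, hF2, hF3⟩ := exists_sortedEigenvalues_decomposition hK.isHermitian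
  have hpos := sortedEigenvalues_pos hK
  set w := sortedEigenvalues hK.isHermitian
  set D := Matrix.diagonal (fun i => √(w i)) with hD
  set Di := Matrix.diagonal (fun i => 1 / √(w i)) with hDi
  have hDDi : D * Di = 1 := by
    rw [hD, hDi, Matrix.diagonal_mul_diagonal, ← Matrix.diagonal_one]
    congr 1
    ext i
    have : √(w i) ≠ 0 := (Real.sqrt_pos.2 (hpos i)).ne'
    field_simp
  have hDD : D * D = Matrix.diagonal w := by
    rw [hD, Matrix.diagonal_mul_diagonal]
    congr 1
    ext i
    exact Real.mul_self_sqrt (hpos i).le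
  set Z := Fᵀ * D
  set W := Di * F
  have hZW : Z * W = 1 := by
    calc Fᵀ * D * (Di * F) = Fᵀ * (D * Di) * F := by simp only [Matrix.mul_assoc]
      _ = 1 := by rw [hDDi, Matrix.mul_one, hF2]
  have hWZ : W * Z = 1 := mul_eq_one_comm.1 hZW
  have hKZ : K = Z * Zᵀ := by
    rw [hF3, ← hDD]
    simp only [Z, Matrix.transpose_mul, Matrix.transpose_transpose, hD, Matrix.diagonal_transpose,
      Matrix.mul_assoc]
  have hS : ((B * Z)ᵀ * (B * Z)).IsHermitian := by
    simpa using Matrix.isHermitian_conjTranspose_mul_self (B * Z)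
  obtain ⟨E, hE1, hE2, hE3⟩ := exists_sortedEigenvalues_decomposition hS
  generalize sortedEigenvalues hS = a at hE3
  have hEK : (E * W) * K * (E * W)ᵀ = 1 := by
    calc (E * W) * K * (E * W)ᵀ = E * (W * Z) * (W * Z)ᵀ * Eᵀ := by
          rw [hKZ]; simp only [Matrix.transpose_mul, Matrix.mul_assoc]
      _ = 1 := by rw [hWZ, Matrix.transpose_one, Matrix.mul_one, Matrix.mul_one, hE1]
  have hBB : Bᵀ * B = (E * W)ᵀ * Matrix.diagonal a * (E * W) := by
    calc Bᵀ * B = (Z * W)ᵀ * (Bᵀ * B) * (Z * W) := by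
          rw [hZW, Matrix.transpose_one, Matrix.one_mul, Matrix.mul_one]
      _ = Wᵀ * ((B * Z)ᵀ * (B * Z)) * W := by
          simp only [Matrix.transpose_mul, Matrix.mul_assoc]
      _ = _ := by rw [hE3]; simp only [Matrix.transpose_mul, Matrix.mul_assoc]
  refine ⟨E * W, a, hEK, fun i => ?_, ?_, hBB⟩
  · have h : Matrix.diagonal a = (B * Z * Eᵀ)ᵀ * (B * Z * Eᵀ) := by
      calc Matrix.diagonal a = (E * Eᵀ) * Matrix.diagonal a * (E * Eᵀ) := by
            rw [hE1, Matrix.one_mul, Matrix.mul_one]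
        _ = E * (Eᵀ * Matrix.diagonal a * E) * Eᵀ := by simp only [Matrix.mul_assoc]
        _ = _ := by
          rw [← hE3]; simp only [Matrix.transpose_mul, Matrix.transpose_transpose, Matrix.mul_assoc]
    have h2 := congrFun (congrFun h i) i
    rw [Matrix.diagonal_apply_eq, Matrix.mul_apply] at h2
    rw [h2]
    exact Finset.sum_nonneg fun r _ => mul_self_nonneg _
  · rw [← Matrix.trace_diagonal]
    calc (Matrix.diagonal a).trace = (Matrix.diagonal a * ((E * W) * K * (E * W)ᵀ)).trace := by
          rw [hEK, Matrix.mul_one]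
      _ = ((E * W)ᵀ * Matrix.diagonal a * (E * W) * K).trace := by
          rw [← Matrix.mul_assoc, Matrix.trace_mul_comm]; simp only [Matrix.mul_assoc]
      _ = _ := by rw [← hBB, Matrix.mul_assoc, Matrix.trace_mul_comm]

theorem frobenius_norm_sq_mul_eq {n m ℓ : ℕ} {B : Matrix (Fin m) (Fin n) ℝ}
    {W : Matrix (Fin n) (Fin n) ℝ} {a : Fin n → ℝ} (h : Bᵀ * B = Wᵀ * Matrix.diagonal a * W)
    (Ω : Matrix (Fin n) (Fin ℓ) ℝ) : ‖B * Ω‖ ^ 2 = ∑ j, ∑ i, a i * (W * Ω) i j ^ 2 := by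
  rw [← Matrix.frobenius_norm_transpose, frobenius_norm_sq_eq_trace, Matrix.transpose_transpose]
  have : (B * Ω)ᵀ * (B * Ω) = (W * Ω)ᵀ * (Matrix.diagonal a * (W * Ω)) := by
    calc _ = Ωᵀ * (Bᵀ * B) * Ω := by simp only [Matrix.transpose_mul, Matrix.mul_assoc]
      _ = _ := by rw [h]; simp only [Matrix.transpose_mul, Matrix.mul_assoc]
  rw [this]
  generalize W * Ω = S
  refine Finset.sum_congr rfl fun j _ => ?_
  rw [Matrix.diag_apply, Matrix.mul_apply]
  exact Finset.sum_congr rfl fun i _ => by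
    rw [Matrix.diagonal_mul, Matrix.transpose_apply]; ring

end Projection

/-! ### Laws of the transformed Gaussian sketch -/

section Law

open Matrix

/-- Comparison of characteristic functions: the covariance WKWᵀ of the image is the identity. -/
theorem map_multivariateGaussian_mulVec {n k : ℕ} {K : Matrix (Fin n) (Fin n) ℝ}
    (hK : K.PosSemidef) {W : Matrix (Fin k) (Fin n) ℝ} (hW : W * K * Wᵀ = 1) :
    (multivariateGaussian 0 K).map (fun x => W *ᵥ x.ofLp) =
      Measure.pi fun _ : Fin k => gaussianReal 0 1 := by
  have hm : Measurable fun x : EuclideanSpace ℝ (Fin n) => WithLp.toLp 2 (W *ᵥ x.ofLp) :=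
    ((toEuclideanLin W).toContinuousLinearMap.continuous).measurable
  have h : (multivariateGaussian 0 K).map (fun x => WithLp.toLp 2 (W *ᵥ x.ofLp)) =
      stdGaussian (EuclideanSpace ℝ (Fin k)) := by
    have := Measure.isProbabilityMeasure_map (μ := multivariateGaussian 0 K) hm.aemeasurable
    apply Measure.ext_of_charFun
    ext t
    rw [charFun_stdGaussian, charFun_apply, integral_map hm.aemeasurable (by fun_prop)]
    have h1 : ∀ x : EuclideanSpace ℝ (Fin n), inner ℝ (WithLp.toLp 2 (W *ᵥ x.ofLp)) t =
        inner ℝ x (WithLp.toLp 2 (Wᵀ *ᵥ t.ofLp)) := by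
      intro x
      rw [EuclideanSpace.inner_eq_star_dotProduct, EuclideanSpace.inner_eq_star_dotProduct]
      simp only [star_trivial]
      rw [Matrix.dotProduct_mulVec, ← Matrix.mulVec_transpose]
    simp_rw [h1]
    rw [← charFun_apply, charFun_multivariateGaussian hK]
    have h2 : (Wᵀ *ᵥ t.ofLp) ⬝ᵥ (K *ᵥ (Wᵀ *ᵥ t.ofLp)) = ‖t‖ ^ 2 := by
      rw [Matrix.mulVec_transpose, ← Matrix.dotProduct_mulVec, ← Matrix.mulVec_transpose,
        Matrix.mulVec_mulVec, Matrix.mulVec_mulVec, hW, Matrix.one_mulVec,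
        EuclideanSpace.real_norm_sq_eq]
      simp [dotProduct, sq]
    simp only [inner_zero_right, h2]
    congr 1
    push_cast
    ring
  have h3 := congrArg (fun μ => μ.map (WithLp.ofLp : EuclideanSpace ℝ (Fin k) → Fin k → ℝ)) h
  simp only [← map_pi_eq_stdGaussian] at h3
  rw [Measure.map_map (by fun_prop) hm, Measure.map_map (by fun_prop) (by fun_prop)] at h3
  simpa [Function.comp_def] using! h3

/-- Both laws agree on boxes, which form a generating π-system. The hypothesis on the sketch is
about columns, while the inverse Gram estimate conditions on rows. -/
theorem measurePreserving_swap_gaussianMatrix (k ℓ : ℕ) :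
    MeasurePreserving (fun (x : Fin ℓ → Fin k → ℝ) i j => x j i)
      (gaussianMatrix ℓ k) (gaussianMatrix k ℓ) := by
  have hm : Measurable fun (x : Fin ℓ → Fin k → ℝ) (i : Fin k) (j : Fin ℓ) => x j i := by fun_prop
  refine ⟨hm, ?_⟩
  rw [gaussianMatrix, gaussianMatrix]
  symm
  refine Measure.pi_eq_generateFrom
    (C := fun _ => Set.univ.pi '' Set.univ.pi fun _ : Fin ℓ => {s : Set ℝ | MeasurableSet s})
    (fun _ => generateFrom_pi) (fun _ => isPiSystem_pi)
    (fun _ => ⟨fun _ => Set.univ, fun _ => ⟨fun _ => Set.univ, by simp, by simp⟩,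
      fun _ => measure_lt_top _ _, Set.iUnion_const _⟩) fun s hs => ?_
  choose t ht hts using hs
  have hpre : (fun (x : Fin ℓ → Fin k → ℝ) (i : Fin k) (j : Fin ℓ) => x j i) ⁻¹' Set.univ.pi s =
      Set.univ.pi fun j => Set.univ.pi fun i => t i j := by
    ext x
    simp only [Set.mem_preimage, Set.mem_univ_pi, ← hts]
    exact forall_comm
  have hsm : MeasurableSet (Set.univ.pi s) := MeasurableSet.univ_pi fun i => by
    rw [← hts i]
    exact MeasurableSet.univ_pi fun j => ht i j (Set.mem_univ j)
  rw [Measure.map_apply hm hsm, hpre, Measure.pi_pi]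
  simp_rw [Measure.pi_pi, ← hts, Measure.pi_pi]
  exact Finset.prod_comm

variable {Θ : Type*} [MeasurableSpace Θ] {P : Measure Θ} {n ℓ : ℕ}
  {K : Matrix (Fin n) (Fin n) ℝ} {Ω : Θ → Matrix (Fin n) (Fin ℓ) ℝ}

theorem IsGaussianSketch.hasLaw_columns (hΩ : IsGaussianSketch P K Ω) (hK : K.PosSemidef)
    {k : ℕ} {W : Matrix (Fin k) (Fin n) ℝ} (hW : W * K * Wᵀ = 1) :
    HasLaw (fun θ j i => (W * Ω θ) i j) (gaussianMatrix ℓ k) P := by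
  have hm : Measurable fun x : EuclideanSpace ℝ (Fin n) => W *ᵥ x.ofLp := by
    have : Continuous fun x : EuclideanSpace ℝ (Fin n) => W *ᵥ x.ofLp :=
      continuous_const.matrix_mulVec (by fun_prop)
    exact this.measurable
  have h1 : ∀ j, HasLaw (fun θ => W *ᵥ (euclideanCol (Ω θ) j).ofLp)
      (Measure.pi fun _ : Fin k => gaussianReal 0 1) P := fun j =>
    HasLaw.comp ⟨hm.aemeasurable, map_multivariateGaussian_mulVec hK hW⟩ (hΩ.law j)
  have h2 := hΩ.indep.comp (fun _ x => W *ᵥ x.ofLp) (fun _ => hm)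
  exact iIndepFun.hasLaw_pi h1 h2

theorem IsGaussianSketch.hasLaw_rows (hΩ : IsGaussianSketch P K Ω) (hK : K.PosSemidef)
    {k : ℕ} {W : Matrix (Fin k) (Fin n) ℝ} (hW : W * K * Wᵀ = 1) :
    HasLaw (fun θ i j => (W * Ω θ) i j) (gaussianMatrix k ℓ) P :=
  (measurePreserving_swap_gaussianMatrix k ℓ).hasLaw.comp (hΩ.hasLaw_columns hK hW)

theorem IsGaussianSketch.aemeasurable_apply (hΩ : IsGaussianSketch P K Ω) (i : Fin n) (j : Fin ℓ) :
    AEMeasurable (fun θ => Ω θ i j) P := by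
  have h : Measurable fun x : EuclideanSpace ℝ (Fin n) => x i := by fun_prop
  exact h.comp_aemeasurable (hΩ.law j).aemeasurable

theorem IsGaussianSketch.aemeasurable_norm_sub_columnProjection (hΩ : IsGaussianSketch P K Ω)
    {m : ℕ} (A : Matrix (Fin m) (Fin n) ℝ) :
    AEMeasurable (fun θ => ‖A - columnProjection (A * Ω θ) * A‖) P := by
  refine (measurable_norm_sub_columnProjection_mul A).comp_aemeasurable
    (f := fun θ i j => (A * Ω θ) i j) ?_
  refine aemeasurable_pi_iff.2 fun i => aemeasurable_pi_iff.2 fun j => ?_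
  simp only [Matrix.mul_apply]
  exact Finset.aemeasurable_fun_sum _ fun c _ => (hΩ.aemeasurable_apply c j).const_mul _

theorem IsGaussianSketch.lintegral_norm_sq_mul (hΩ : IsGaussianSketch P K Ω) (hK : K.PosDef)
    {m : ℕ} (B : Matrix (Fin m) (Fin n) ℝ) :
    ∫⁻ θ, ENNReal.ofReal (‖B * Ω θ‖ ^ 2) ∂P = ENNReal.ofReal (ℓ * (B * K * Bᵀ).trace) := by
  obtain ⟨W, a, hW, ha, hsum, hB⟩ := exists_whitening hK B
  have hlaw := hΩ.hasLaw_columns hK.posSemidef hW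
  simp_rw [frobenius_norm_sq_mul_eq hB]
  have hmeas : Measurable fun x : Fin ℓ → Fin n → ℝ =>
      ENNReal.ofReal (∑ j, ∑ i, a i * x j i ^ 2) := by fun_prop
  have h := hlaw.lintegral_comp hmeas.aemeasurable
  refine h.trans ?_
  have hnn : ∀ (x : Fin ℓ → Fin n → ℝ) (j : Fin ℓ), 0 ≤ ∑ i, a i * x j i ^ 2 := fun x j =>
    Finset.sum_nonneg fun i _ => mul_nonneg (ha i) (sq_nonneg _)
  simp_rw [ENNReal.ofReal_sum_of_nonneg (fun j (_ : j ∈ Finset.univ) => hnn _ j)]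
  rw [lintegral_finsetSum _ fun j _ => by fun_prop]
  have hj : ∀ j : Fin ℓ, ∫⁻ x, ENNReal.ofReal (∑ i, a i * x j i ^ 2) ∂gaussianMatrix ℓ n =
      ENNReal.ofReal (∑ i, a i) := fun j => by
    rw [← lintegral_pi_gaussianReal_sum_sq a ha]
    exact (measurePreserving_eval (fun _ : Fin ℓ => Measure.pi fun _ : Fin n => gaussianReal 0 1)
      j).lintegral_comp (f := fun x : Fin n → ℝ => ENNReal.ofReal (∑ i, a i * x i ^ 2))
      (by fun_prop)
  simp_rw [hj]
  rw [hsum, Finset.sum_const, Finset.card_univ, Fintype.card_fin, nsmul_eq_mul,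
    ENNReal.ofReal_mul (by positivity), ENNReal.ofReal_natCast]

theorem IsGaussianSketch.lintegral_exp_norm_sq_mul_le (hΩ : IsGaussianSketch P K Ω) (hK : K.PosDef)
    {m : ℕ} (B : Matrix (Fin m) (Fin n) ℝ) {c b : ℝ} (hc : 0 ≤ c)
    (hcb : c * (B * K * Bᵀ).trace ≤ b) (hb : b < 1 / 2) :
    ∫⁻ θ, ENNReal.ofReal (Real.exp (c * ‖B * Ω θ‖ ^ 2)) ∂P ≤
      ENNReal.ofReal ((1 - 2 * b) ^ (-(1 / 2) : ℝ)) ^ ℓ := by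
  obtain ⟨W, a, hW, ha, hsum, hB⟩ := exists_whitening hK B
  have hlaw := hΩ.hasLaw_columns hK.posSemidef hW
  have hexp : ∀ θ, ENNReal.ofReal (Real.exp (c * ‖B * Ω θ‖ ^ 2)) =
      ∏ j, ENNReal.ofReal (Real.exp (∑ i, (c * a i) * (W * Ω θ) i j ^ 2)) := fun θ => by
    rw [frobenius_norm_sq_mul_eq hB, Finset.mul_sum, Real.exp_sum,
      ENNReal.ofReal_prod_of_nonneg fun j _ => (Real.exp_pos _).le]
    simp_rw [Finset.mul_sum, mul_assoc]
  simp_rw [hexp]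
  have hmeas : Measurable fun x : Fin ℓ → Fin n → ℝ =>
      ∏ j, ENNReal.ofReal (Real.exp (∑ i, (c * a i) * x j i ^ 2)) := by fun_prop
  have hind : iIndepFun (fun (j : Fin ℓ) (x : Fin ℓ → Fin n → ℝ) =>
      ENNReal.ofReal (Real.exp (∑ i, (c * a i) * x j i ^ 2))) (gaussianMatrix ℓ n) :=
    iIndepFun_pi (X := fun _ (x : Fin n → ℝ) => ENNReal.ofReal (Real.exp (∑ i, (c * a i) * x i ^ 2)))
      (fun _ => (show Measurable fun x : Fin n → ℝ =>
        ENNReal.ofReal (Real.exp (∑ i, (c * a i) * x i ^ 2)) by fun_prop).aemeasurable)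
  refine (hlaw.lintegral_comp hmeas.aemeasurable).trans_le ?_
  rw [lintegral_prod_eq_prod_lintegral_of_indepFun _ _ hind fun j => by fun_prop]
  refine (Finset.prod_le_pow_card _ _ (ENNReal.ofReal ((1 - 2 * b) ^ (-(1 / 2) : ℝ)))
    fun j _ => ?_).trans_eq (by simp)
  refine le_of_eq_of_le ?_ (lintegral_pi_gaussianReal_exp_sum_sq_le (a := fun i => c * a i)
    (fun i => mul_nonneg hc (ha i)) (by rwa [← Finset.mul_sum, hsum]) hb)
  exact (measurePreserving_eval (fun _ : Fin ℓ => Measure.pi fun _ : Fin n => gaussianReal 0 1)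
      j).lintegral_comp (f := fun x : Fin n → ℝ => ENNReal.ofReal (Real.exp (∑ i, (c * a i) * x i ^ 2)))
      (by fun_prop)

end Law

/-! ### Moments and tails of the weighted inverse Gram trace -/

/-- The diagonal entries are dependent; Jensen with weights c_i/C needs only their individual
moments. -/
theorem lintegral_sum_mul_gramInv_rpow_le {n ℓ : ℕ} {q : ℝ} (hq : 1 ≤ q)
    (hqℓ : q < ((ℓ - n : ℕ) : ℝ) / 2) {c : Fin (n + 1) → ℝ} (hc : ∀ i, 0 < c i) :
    ∫⁻ G, ENNReal.ofReal (∑ i, c i * gramInv 0 G i i) ^ q ∂gaussianMatrix (n + 1) ℓ ≤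
      ENNReal.ofReal ((∑ i, c i) ^ q * invChiSqMoment (ℓ - n : ℕ) q) := by
  set C := ∑ i, c i with hC
  have hC0 : 0 < C := Finset.sum_pos (fun i _ => hc i) Finset.univ_nonempty
  have hw : ∑ i, ENNReal.ofReal (c i / C) = 1 := by
    rw [← ENNReal.ofReal_sum_of_nonneg fun i _ => (div_pos (hc i) hC0).le, ← Finset.sum_div,
      div_self hC0.ne', ENNReal.ofReal_one]
  have hpt : ∀ G : Fin (n + 1) → Fin ℓ → ℝ, ENNReal.ofReal (∑ i, c i * gramInv 0 G i i) ^ q ≤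
      ENNReal.ofReal (C ^ q) *
        ∑ i, ENNReal.ofReal (c i / C) * ENNReal.ofReal (gramInv 0 G i i) ^ q := by
    intro G
    have h1 : ENNReal.ofReal (∑ i, c i * gramInv 0 G i i) = ENNReal.ofReal C *
        ∑ i, ENNReal.ofReal (c i / C) * ENNReal.ofReal (gramInv 0 G i i) := by
      rw [Finset.mul_sum, ENNReal.ofReal_sum_of_nonneg fun i _ =>
        mul_nonneg (hc i).le (gramInv_diag_nonneg le_rfl G i)]
      refine Finset.sum_congr rfl fun i _ => ?_
      rw [← mul_assoc, ← ENNReal.ofReal_mul hC0.le, mul_div_cancel₀ _ hC0.ne',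
        ENNReal.ofReal_mul (hc i).le]
    rw [h1, ENNReal.mul_rpow_of_nonneg _ _ (by linarith), ENNReal.ofReal_rpow_of_pos hC0]
    gcongr
    exact ENNReal.rpow_arith_mean_le_arith_mean_rpow _ _ _ hw hq
  have hm : ∀ i, Measurable fun G : Fin (n + 1) → Fin ℓ → ℝ =>
      ENNReal.ofReal (gramInv 0 G i i) ^ q := fun i =>
    (measurable_gramInv_apply 0 i i).ennreal_ofReal.pow_const q
  refine (lintegral_mono hpt).trans ?_
  rw [lintegral_const_mul' _ _ ENNReal.ofReal_ne_top,
    lintegral_finsetSum _ fun i _ => (hm i).const_mul _, ENNReal.ofReal_mul (by positivity)]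
  gcongr
  calc _ ≤ ∑ i, ENNReal.ofReal (c i / C) * ENNReal.ofReal (invChiSqMoment (ℓ - n : ℕ) q) := by
        refine Finset.sum_le_sum fun i _ => ?_
        rw [lintegral_const_mul' _ _ ENNReal.ofReal_ne_top]
        gcongr
        exact lintegral_gramInv_rpow_le le_rfl (by linarith) hqℓ i
    _ = _ := by rw [← Finset.sum_mul, hw, one_mul]

theorem gaussianMatrix_sum_mul_gramInv_ge_le {n p : ℕ} (hp : 4 ≤ p)
    {c : Fin (n + 1) → ℝ} (hc : ∀ i, 0 < c i) {t : ℝ} (ht : 1 ≤ t) :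
    gaussianMatrix (n + 1) (n + 1 + p)
      {G | 3 * t ^ 2 * (∑ i, c i) / (p + 1) ≤ ∑ i, c i * gramInv 0 G i i} ≤
      ENNReal.ofReal (t ^ p)⁻¹ := by
  set C := ∑ i, c i with hC
  have hC0 : 0 < C := Finset.sum_pos (fun i _ => hc i) Finset.univ_nonempty
  -- This exponent is below the critical (p+1)/2 and turns the factor t² of the threshold into t^p.
  set q : ℝ := (p : ℝ) / 2 with hq
  have hp4 : (4 : ℝ) ≤ p := by exact_mod_cast hp
  have hdim : n + 1 + p - n = p + 1 := by omega
  have hmom := lintegral_sum_mul_gramInv_rpow_le (n := n) (ℓ := n + 1 + p) (q := q)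
    (by rw [hq]; linarith) (by rw [hdim, hq]; push_cast; linarith) hc
  rw [hdim] at hmom
  push_cast at hmom
  set τ := 3 * t ^ 2 * C / (p + 1) with hτ
  have ht0 : 0 < t := by linarith
  have hτ0 : 0 < τ := by positivity
  have hmeas : Measurable fun G : Fin (n + 1) → Fin (n + 1 + p) → ℝ =>
      ENNReal.ofReal (∑ i, c i * gramInv 0 G i i) ^ q :=
    (Finset.measurable_sum _ fun i _ =>
      (measurable_gramInv_apply 0 i i).const_mul (c i)).ennreal_ofReal.pow_const q
  have hsub : {G : Fin (n + 1) → Fin (n + 1 + p) → ℝ | τ ≤ ∑ i, c i * gramInv 0 G i i} ⊆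
      {G | ENNReal.ofReal (τ ^ q) ≤ ENNReal.ofReal (∑ i, c i * gramInv 0 G i i) ^ q} := by
    intro G hG
    rw [Set.mem_ofPred_eq, ← ENNReal.ofReal_rpow_of_pos hτ0]
    exact ENNReal.rpow_le_rpow (ENNReal.ofReal_le_ofReal hG) (by positivity)
  refine (measure_mono hsub).trans ((meas_ge_le_lintegral_div hmeas.aemeasurable
    (by simpa using Real.rpow_pos_of_pos hτ0 q) ENNReal.ofReal_ne_top).trans ?_)
  refine (ENNReal.div_le_div_right hmom _).trans ?_
  rw [← ENNReal.ofReal_div_of_pos (by positivity)]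
  refine ENNReal.ofReal_le_ofReal ?_
  rw [div_le_iff₀ (by positivity)]
  calc C ^ q * invChiSqMoment (p + 1) q ≤ C ^ q * (3 / ((p : ℝ) + 1)) ^ q := by
        gcongr; exact invChiSqMoment_half_le hp
    _ = (t ^ p)⁻¹ * τ ^ q := by
      have : τ = t ^ 2 * (C * (3 / (p + 1))) := by rw [hτ]; ring
      rw [this, Real.mul_rpow (by positivity) (by positivity),
        Real.mul_rpow (by positivity) (by positivity), ← Real.rpow_natCast t 2,
        ← Real.rpow_mul ht0.le, show ((2 : ℕ) : ℝ) * q = p by rw [hq]; push_cast; ring,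
        Real.rpow_natCast]
      field_simp

/-! ### Tail of ‖BΩ‖² and choice of singular rows -/

section Sketch

open Matrix

variable {Θ : Type*} [MeasurableSpace Θ] {P : Measure Θ} {n ℓ : ℕ}
  {K : Matrix (Fin n) (Fin n) ℝ} {Ω : Θ → Matrix (Fin n) (Fin ℓ) ℝ}

theorem IsGaussianSketch.aemeasurable_norm_mul (hΩ : IsGaussianSketch P K Ω)
    {m : ℕ} (B : Matrix (Fin m) (Fin n) ℝ) : AEMeasurable (fun θ => ‖B * Ω θ‖) P := by
  have h : Continuous fun Y : Fin n → Fin ℓ → ℝ => ‖B * Matrix.of Y‖ := by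
    have h1 : Continuous fun Y : Fin n → Fin ℓ → ℝ => Matrix.of Y := continuous_id
    exact (continuous_const.matrix_mul h1).norm
  exact h.measurable.comp_aemeasurable (f := fun θ i j => Ω θ i j)
    (aemeasurable_pi_iff.2 fun i => aemeasurable_pi_iff.2 fun j => hΩ.aemeasurable_apply i j)

theorem IsGaussianSketch.measure_norm_sq_mul_gt_le (hΩ : IsGaussianSketch P K Ω) (hK : K.PosDef)
    {m : ℕ} (B : Matrix (Fin m) (Fin n) ℝ) {s a : ℝ} (hs : 1 ≤ s)
    (ha : (B * K * Bᵀ).trace ≤ a) (ha0 : a = 0 → B = 0) (hann : 0 ≤ a) :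
    P {θ | ℓ * s ^ 2 * a < ‖B * Ω θ‖ ^ 2} ≤
      ENNReal.ofReal ((s * Real.exp (-(s ^ 2 - 1) / 2)) ^ ℓ) := by
  -- If `a = 0` then `B = 0`, and the event is empty because its inequality is strict.
  rcases hann.eq_or_lt with h0 | hapos
  · have hB := ha0 h0.symm
    simp [hB, ← h0]
  have hs0 : 0 < s := by linarith
  have hs2 : 1 / s ^ 2 ≤ 1 := by
    rw [div_le_one (by positivity)]
    exact one_le_pow₀ hs
  -- The optimal Chernoff parameter: 1 - 2ca = 1/s², so each column contributes exactly the factor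
  -- s.
  set c := (1 - 1 / s ^ 2) / (2 * a) with hc
  have hc0 : 0 ≤ c := div_nonneg (by linarith) (by positivity)
  have hca : c * a = (1 - 1 / s ^ 2) / 2 := by rw [hc]; field_simp
  have hspos : 0 < 1 / s ^ 2 := by positivity
  have hI := hΩ.lintegral_exp_norm_sq_mul_le hK B hc0
    (mul_le_mul_of_nonneg_left ha hc0) (by rw [hca]; linarith)
  have hval : (1 - 2 * (c * a)) ^ (-(1 / 2) : ℝ) = s := by
    rw [hca, show 1 - 2 * ((1 - 1 / s ^ 2) / 2) = (s ^ 2)⁻¹ by ring,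
      Real.rpow_neg (by positivity), ← Real.inv_rpow (by positivity), inv_inv,
      ← Real.sqrt_eq_rpow, Real.sqrt_sq hs0.le]
  rw [hval] at hI
  have hE : 0 < Real.exp (c * (ℓ * s ^ 2 * a)) := Real.exp_pos _
  have hsub : {θ | ℓ * s ^ 2 * a < ‖B * Ω θ‖ ^ 2} ⊆
      {θ | ENNReal.ofReal (Real.exp (c * (ℓ * s ^ 2 * a))) ≤
        ENNReal.ofReal (Real.exp (c * ‖B * Ω θ‖ ^ 2))} := by
    intro θ hθ
    refine ENNReal.ofReal_le_ofReal (Real.exp_le_exp.2 ?_)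
    exact mul_le_mul_of_nonneg_left (le_of_lt hθ) hc0
  refine (measure_mono hsub).trans ((meas_ge_le_lintegral_div ?_ (by simpa using hE)
    ENNReal.ofReal_ne_top).trans ?_)
  · exact (Real.measurable_exp.comp_aemeasurable
      (((hΩ.aemeasurable_norm_mul B).pow_const 2).const_mul c)).ennreal_ofReal
  · refine (ENNReal.div_le_div_right hI _).trans ?_
    rw [← ENNReal.ofReal_pow hs0.le, ← ENNReal.ofReal_div_of_pos hE]
    refine ENNReal.ofReal_le_ofReal (le_of_eq ?_)
    have : c * (ℓ * s ^ 2 * a) = -(ℓ * (-(s ^ 2 - 1) / 2)) := by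
      rw [show c * (ℓ * s ^ 2 * a) = ℓ * s ^ 2 * (c * a) by ring, hca]
      field_simp
    rw [this, Real.exp_neg, Real.exp_nat_mul, div_inv_eq_mul, mul_pow]

/-- Rows spanning a dominant right singular space of `A` along which `K` is diagonal. -/
theorem exists_singular_rows_diagonalizing {k n₂ : ℕ} (hkn : k ≤ n)
    (A : Matrix (Fin n₂) (Fin n) ℝ) (hK : K.PosDef) :
    ∃ (V : Matrix (Fin k) (Fin n) ℝ) (d : Fin k → ℝ), V * Vᵀ = 1 ∧
      V * K * Vᵀ = Matrix.diagonal d ∧ (∀ i, 0 < d i) ∧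
      (Matrix.diagonal (fun i => 1 / √(d i)) * V) * K *
        (Matrix.diagonal (fun i => 1 / √(d i)) * V)ᵀ = 1 ∧
      ‖A - A * Vᵀ * V‖ = √(∑' j : ℕ, singularValue A (k + j) ^ 2) := by
  obtain ⟨V₀, hV₀, hnorm⟩ := exists_dominant_right_singular_rows hkn A
  obtain ⟨V, d, hV, hVV, hd⟩ := exists_rows_diagonalizing hV₀ hK.isHermitian
  have hpos := diag_pos_of_rows hK hV hd
  refine ⟨V, d, hV, hd, hpos, ?_, ?_⟩
  · have : ∀ Δ : Matrix (Fin k) (Fin k) ℝ, Δ * V * K * (Δ * V)ᵀ = Δ * (V * K * Vᵀ) * Δᵀ := by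
      intro Δ
      simp only [Matrix.transpose_mul, Matrix.mul_assoc]
    rw [this, hd, Matrix.diagonal_transpose, Matrix.diagonal_mul_diagonal,
      Matrix.diagonal_mul_diagonal, ← Matrix.diagonal_one]
    congr 1
    ext i
    have h1 : √(d i) ≠ 0 := (Real.sqrt_pos.2 (hpos i)).ne'
    have h2 : √(d i) ^ 2 = d i := Real.sq_sqrt (hpos i).le
    field_simp
    rw [h2]
  · rw [← hnorm, Matrix.mul_assoc, hVV, ← Matrix.mul_assoc, Real.sqrt_sq (norm_nonneg _)]

/-- The squared Frobenius norm of the pseudo-inverse of the sketch along the rows of `V`. -/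
noncomputable def sketchInvTrace {k : ℕ} (V : Matrix (Fin k) (Fin n) ℝ) (d : Fin k → ℝ)
    (M : Matrix (Fin n) (Fin ℓ) ℝ) : ℝ :=
  ∑ i, 1 / d i * gramInv 0
    (fun i j => (Matrix.diagonal (fun i => 1 / √(d i)) * V * M) i j) i i

end Sketch

/-! ### Estimates for the two random factors -/

section Main

open Matrix

variable {Θ : Type*} [MeasurableSpace Θ] {P : Measure Θ} {n m p : ℕ}
  {K : Matrix (Fin m) (Fin m) ℝ} {Ω : Θ → Matrix (Fin m) (Fin (n + 1 + p)) ℝ}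
  {V : Matrix (Fin (n + 1)) (Fin m) ℝ} {d : Fin (n + 1) → ℝ}

theorem IsGaussianSketch.ae_norm_sub_columnProjection_le (hΩ : IsGaussianSketch P K Ω)
    (hK : K.PosDef) (hp : 2 ≤ p) {n₂ : ℕ} (A : Matrix (Fin n₂) (Fin m) ℝ) (hV : V * Vᵀ = 1)
    (hd : ∀ i, 0 < d i) (hW : (Matrix.diagonal (fun i => 1 / √(d i)) * V) * K *
        (Matrix.diagonal (fun i => 1 / √(d i)) * V)ᵀ = 1) :
    ∀ᵐ θ ∂P, ‖A - columnProjection (A * Ω θ) * A‖ ≤ ‖A - A * Vᵀ * V‖ +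
      ‖(A - A * Vᵀ * V) * Ω θ‖ * √(sketchInvTrace V d (Ω θ)) := by
  have hlaw := hΩ.hasLaw_rows hK.posSemidef hW
  have hae := ae_isUnit_det_gram (n := n) (ℓ := n + 1 + p) (by omega)
  rw [← hlaw.map_eq] at hae
  filter_upwards [ae_of_ae_map hlaw.aemeasurable hae] with θ hθ
  exact norm_sub_columnProjection_mul_le_add A hV hd (Ω θ) _ rfl hθ

theorem sketchInvTrace_nonneg {ℓ k : ℕ} {V : Matrix (Fin k) (Fin m) ℝ} {d : Fin k → ℝ}
    (hd : ∀ i, 0 < d i) (M : Matrix (Fin m) (Fin ℓ) ℝ) : 0 ≤ sketchInvTrace V d M :=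
  Finset.sum_nonneg fun i _ =>
    mul_nonneg (one_div_pos.2 (hd i)).le (gramInv_diag_nonneg le_rfl _ i)

theorem measurable_sum_mul_gramInv {k ℓ : ℕ} (c : Fin k → ℝ) :
    Measurable fun G : Fin k → Fin ℓ → ℝ => ∑ i, c i * gramInv 0 G i i :=
  Finset.measurable_sum _ fun i _ => (measurable_gramInv_apply 0 i i).const_mul (c i)

theorem IsGaussianSketch.aemeasurable_sketchInvTrace (hΩ : IsGaussianSketch P K Ω)
    (hK : K.PosDef) (hW : (Matrix.diagonal (fun i => 1 / √(d i)) * V) * K *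
        (Matrix.diagonal (fun i => 1 / √(d i)) * V)ᵀ = 1) :
    AEMeasurable (fun θ => sketchInvTrace V d (Ω θ)) P :=
  (measurable_sum_mul_gramInv fun i => 1 / d i).comp_aemeasurable
    (hΩ.hasLaw_rows hK.posSemidef hW).aemeasurable

theorem IsGaussianSketch.lintegral_sketchInvTrace_le (hΩ : IsGaussianSketch P K Ω)
    (hK : K.PosDef) (hp : 2 ≤ p) (hd : ∀ i, 0 < d i)
    (hW : (Matrix.diagonal (fun i => 1 / √(d i)) * V) * K *
        (Matrix.diagonal (fun i => 1 / √(d i)) * V)ᵀ = 1) :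
    ∫⁻ θ, ENNReal.ofReal (sketchInvTrace V d (Ω θ)) ∂P ≤
      ENNReal.ofReal ((∑ i, 1 / d i) / (p - 1)) := by
  have hlaw := hΩ.hasLaw_rows hK.posSemidef hW
  have hp2 : (2 : ℝ) ≤ p := by exact_mod_cast hp
  have hdim : n + 1 + p - n = p + 1 := by omega
  have h := lintegral_sum_mul_gramInv_rpow_le (n := n) (ℓ := n + 1 + p) le_rfl
    (by rw [hdim]; push_cast; linarith) (c := fun i => 1 / d i) fun i => one_div_pos.2 (hd i)
  rw [hdim] at h
  push_cast at h
  rw [invChiSqMoment_one (by linarith)] at h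
  simp only [ENNReal.rpow_one, Real.rpow_one] at h
  refine (hlaw.lintegral_comp
    (measurable_sum_mul_gramInv fun i => 1 / d i).ennreal_ofReal.aemeasurable).trans_le
    (h.trans (ENNReal.ofReal_le_ofReal (le_of_eq ?_)))
  rw [mul_one_div]
  congr 1
  ring

theorem IsGaussianSketch.measure_sketchInvTrace_ge_le (hΩ : IsGaussianSketch P K Ω)
    (hK : K.PosDef) (hp : 4 ≤ p) (hd : ∀ i, 0 < d i)
    (hW : (Matrix.diagonal (fun i => 1 / √(d i)) * V) * K *
        (Matrix.diagonal (fun i => 1 / √(d i)) * V)ᵀ = 1) {t : ℝ} (ht : 1 ≤ t) :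
    P {θ | 3 * t ^ 2 * (∑ i, 1 / d i) / (p + 1) ≤ sketchInvTrace V d (Ω θ)} ≤
      ENNReal.ofReal (t ^ p)⁻¹ := by
  have hlaw := hΩ.hasLaw_rows hK.posSemidef hW
  refine le_of_eq_of_le ?_ (gaussianMatrix_sum_mul_gramInv_ge_le (n := n) hp
    (c := fun i => 1 / d i) (fun i => one_div_pos.2 (hd i)) ht)
  exact hlaw.measure_eq (measurableSet_le measurable_const (measurable_sum_mul_gramInv _))

/-- Cauchy–Schwarz, applied to ‖BΩ‖ and ‖X‖: a general K correlates them, so the expectation of the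
product does not factor. -/
theorem lintegral_mul_sqrt_le {f g : Θ → ℝ} (hf : AEMeasurable f P) (hg : AEMeasurable g P)
    (hf0 : ∀ θ, 0 ≤ f θ) (hg0 : ∀ θ, 0 ≤ g θ) {a b : ℝ} (ha : 0 ≤ a) (hb : 0 ≤ b)
    (hfa : ∫⁻ θ, ENNReal.ofReal (f θ ^ 2) ∂P ≤ ENNReal.ofReal a)
    (hgb : ∫⁻ θ, ENNReal.ofReal (g θ) ∂P ≤ ENNReal.ofReal b) :
    ∫⁻ θ, ENNReal.ofReal (f θ * √(g θ)) ∂P ≤ ENNReal.ofReal √(a * b) := by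
  have hr : AEMeasurable (fun θ => √(g θ)) P :=
    Real.continuous_sqrt.measurable.comp_aemeasurable hg
  have h := ENNReal.lintegral_mul_le_Lp_mul_Lq P Real.HolderConjugate.two_two
    hf.ennreal_ofReal hr.ennreal_ofReal
  have e1 : ∀ θ, ENNReal.ofReal (f θ) ^ (2 : ℝ) = ENNReal.ofReal (f θ ^ 2) := fun θ => by
    rw [ENNReal.ofReal_rpow_of_nonneg (hf0 θ) (by norm_num), Real.rpow_ofNat]
  have e2 : ∀ θ, ENNReal.ofReal √(g θ) ^ (2 : ℝ) = ENNReal.ofReal (g θ) := fun θ => by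
    rw [ENNReal.ofReal_rpow_of_nonneg (Real.sqrt_nonneg _) (by norm_num), Real.rpow_ofNat,
      Real.sq_sqrt (hg0 θ)]
  simp only [Pi.mul_apply, e1, e2] at h
  have e3 : ∀ θ, ENNReal.ofReal (f θ * √(g θ)) =
      ENNReal.ofReal (f θ) * ENNReal.ofReal √(g θ) := fun θ =>
    ENNReal.ofReal_mul (hf0 θ)
  simp_rw [e3]
  refine h.trans ?_
  rw [Real.sqrt_mul ha, ENNReal.ofReal_mul (Real.sqrt_nonneg _), Real.sqrt_eq_rpow,
    Real.sqrt_eq_rpow, ← ENNReal.ofReal_rpow_of_nonneg ha (by norm_num),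
    ← ENNReal.ofReal_rpow_of_nonneg hb (by norm_num)]
  gcongr

end Main

/-! ### Expectation and tail of the projection error -/

open Matrix in
theorem IsGaussianSketch.integral_norm_sub_columnProjection_le {Θ : Type*} [MeasurableSpace Θ]
    {P : Measure Θ} [IsProbabilityMeasure P]
    {n₁ n₂ k p : ℕ} (A : Matrix (Fin n₂) (Fin n₁) ℝ)
    (hk : 1 ≤ k) (hkn : k ≤ n₁) (hp : 2 ≤ p)
    {K : Matrix (Fin n₁) (Fin n₁) ℝ} (hK : K.PosDef)
    {Ω : Θ → Matrix (Fin n₁) (Fin (k + p)) ℝ} (hΩ : IsGaussianSketch P K Ω) :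
    Integrable (fun θ => ‖A - columnProjection (A * Ω θ) * A‖) P ∧
      ∫ θ, ‖A - columnProjection (A * Ω θ) * A‖ ∂P ≤
        (1 + √(((k + p : ℝ) / (p - 1 : ℝ)) *
            ∑ j : Fin n₁ with n₁ - k ≤ j.val,
              sortedEigenvalues hK.isHermitian ⟨0, hk.trans hkn⟩ /
                sortedEigenvalues hK.isHermitian j)) *
          √(∑' j : ℕ, singularValue A (k + j) ^ 2) := by
  have hint : Integrable (fun θ => ‖A - columnProjection (A * Ω θ) * A‖) P :=
    Integrable.of_bound (hΩ.aemeasurable_norm_sub_columnProjection A).aestronglyMeasurable ‖A‖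
      (Filter.Eventually.of_forall fun θ => by
        simpa using norm_sub_columnProjection_mul_le_norm (A * Ω θ) A)
  refine ⟨hint, ?_⟩
  obtain ⟨V, d, hV, hVK, hd, hW, hnorm⟩ := exists_singular_rows_diagonalizing hkn A hK
  have hsum := sum_inv_diag_le hk hkn hK hV hVK
  have hpos := sortedEigenvalues_pos hK
  have htr := trace_mul_mul_transpose_le hK (A - A * Vᵀ * V) (hk.trans hkn)
  rw [← hnorm]
  set w := sortedEigenvalues hK.isHermitian
  set w₀ := w ⟨0, hk.trans hkn⟩ with hw₀
  have hw₀pos : 0 < w₀ := hpos _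
  set B := A - A * Vᵀ * V with hB
  set Λ := ∑ j : Fin n₁ with n₁ - k ≤ j.val, 1 / w j
  have hΛ : ∑ j : Fin n₁ with n₁ - k ≤ j.val, w₀ / w j = w₀ * Λ := by
    rw [Finset.mul_sum]
    exact Finset.sum_congr rfl fun j _ => by ring
  rw [hΛ]
  obtain ⟨n, rfl⟩ := Nat.exists_eq_add_of_le' hk
  have hp1 : (0 : ℝ) < p - 1 := by
    have : (2 : ℝ) ≤ p := by exact_mod_cast hp
    linarith
  have hΛ0 : 0 ≤ Λ := Finset.sum_nonneg fun j _ => (one_div_pos.2 (hpos j)).le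
  have h2 : ∫⁻ θ, ENNReal.ofReal (‖B * Ω θ‖ * √(sketchInvTrace V d (Ω θ))) ∂P ≤
      ENNReal.ofReal √((((n + 1 + p : ℕ) : ℝ) * (w₀ * ‖B‖ ^ 2)) * (Λ / (p - 1))) := by
    refine lintegral_mul_sqrt_le (hΩ.aemeasurable_norm_mul B)
      (hΩ.aemeasurable_sketchInvTrace hK hW) (fun θ => norm_nonneg _)
      (fun θ => sketchInvTrace_nonneg hd _) (by positivity) (by positivity) ?_ ?_
    · rw [hΩ.lintegral_norm_sq_mul hK B]
      exact ENNReal.ofReal_le_ofReal (by gcongr)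
    · refine (hΩ.lintegral_sketchInvTrace_le hK hp hd hW).trans (ENNReal.ofReal_le_ofReal ?_)
      gcongr
  -- Working with extended nonnegative integrals requires no integrability of the product ‖BΩ‖‖X‖.
  have hle : ENNReal.ofReal (∫ θ, ‖A - columnProjection (A * Ω θ) * A‖ ∂P) ≤
      ENNReal.ofReal (‖B‖ +
        √((((n + 1 + p : ℕ) : ℝ) * (w₀ * ‖B‖ ^ 2)) * (Λ / (p - 1)))) := by
    rw [ofReal_integral_eq_lintegral_ofReal hint
      (Filter.Eventually.of_forall fun θ => norm_nonneg _)]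
    calc _ ≤ ∫⁻ θ, (ENNReal.ofReal ‖B‖ +
          ENNReal.ofReal (‖B * Ω θ‖ * √(sketchInvTrace V d (Ω θ)))) ∂P := by
          refine lintegral_mono_ae ?_
          filter_upwards [hΩ.ae_norm_sub_columnProjection_le hK hp A hV hd hW] with θ hθ
          rw [← ENNReal.ofReal_add (norm_nonneg _) (by positivity)]
          exact ENNReal.ofReal_le_ofReal hθ
      _ ≤ _ := by
          rw [lintegral_add_left measurable_const, lintegral_const, measure_univ, mul_one,
            ENNReal.ofReal_add (norm_nonneg _) (Real.sqrt_nonneg _)]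
          gcongr
  rw [ENNReal.ofReal_le_ofReal_iff (by positivity)] at hle
  refine hle.trans (le_of_eq ?_)
  have : (((n + 1 + p : ℕ) : ℝ) * (w₀ * ‖B‖ ^ 2)) * (Λ / (p - 1)) =
      (((n + 1 : ℕ) + p : ℝ) / (p - 1) * (w₀ * Λ)) * ‖B‖ ^ 2 := by
    push_cast
    ring
  rw [this, Real.sqrt_mul (by positivity), Real.sqrt_sq (norm_nonneg _)]
  ring

open Matrix in
theorem IsGaussianSketch.measureReal_norm_sub_columnProjection_le_ge {Θ : Type*}
    [MeasurableSpace Θ] {P : Measure Θ} [IsProbabilityMeasure P]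
    {n₁ n₂ k p : ℕ} (A : Matrix (Fin n₂) (Fin n₁) ℝ)
    (hk : 1 ≤ k) (hkn : k ≤ n₁) (hp : 4 ≤ p)
    {K : Matrix (Fin n₁) (Fin n₁) ℝ} (hK : K.PosDef)
    {Ω : Θ → Matrix (Fin n₁) (Fin (k + p)) ℝ} (hΩ : IsGaussianSketch P K Ω)
    {s t : ℝ} (hs : 1 ≤ s) (ht : 1 ≤ t) :
    1 - (t ^ p)⁻¹ - (s * Real.exp (-(s ^ 2 - 1) / 2)) ^ (k + p) ≤
      P.real {θ | ‖A - columnProjection (A * Ω θ) * A‖ ≤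
        (1 + t * s * √((3 * (k + p : ℝ) / (p + 1 : ℝ)) *
            (∑ j : Fin n₁, sortedEigenvalues hK.isHermitian j) *
            ∑ j : Fin n₁ with n₁ - k ≤ j.val,
              1 / sortedEigenvalues hK.isHermitian j)) *
          √(∑' j : ℕ, singularValue A (k + j) ^ 2)} := by
  obtain ⟨V, d, hV, hVK, hd, hW, hnorm⟩ := exists_singular_rows_diagonalizing hkn A hK
  have hsum := sum_inv_diag_le hk hkn hK hV hVK
  have hpos := sortedEigenvalues_pos hK
  have htr := trace_mul_mul_transpose_le hK (A - A * Vᵀ * V) (hk.trans hkn)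
  rw [← hnorm]
  set w := sortedEigenvalues hK.isHermitian
  set w₀ := w ⟨0, hk.trans hkn⟩ with hw₀
  have hw₀pos : 0 < w₀ := hpos _
  -- The argument controls ‖BΩ‖² through the largest eigenvalue alone; the trace of K in the
  -- statement comes from this weakening.
  have hw₀le : w₀ ≤ ∑ j, w j :=
    Finset.single_le_sum (f := w) (fun j _ => (hpos j).le) (Finset.mem_univ _)
  set B := A - A * Vᵀ * V with hB
  set Λ := ∑ j : Fin n₁ with n₁ - k ≤ j.val, 1 / w j
  have hΛ0 : 0 ≤ Λ := Finset.sum_nonneg fun j _ => (one_div_pos.2 (hpos j)).le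
  obtain ⟨n, rfl⟩ := Nat.exists_eq_add_of_le' hk
  set S := {θ | ‖A - columnProjection (A * Ω θ) * A‖ ≤
        (1 + t * s * √((3 * ((n + 1 : ℕ) + p : ℝ) / (p + 1 : ℝ)) *
            (∑ j : Fin n₁, w j) * Λ)) * ‖B‖} with hS
  -- The exceptional events: a null set where the deterministic bound fails, a large ‖X‖², and a
  -- large ‖BΩ‖². Outside them the error bound holds, so a union bound finishes.
  set E₁ := {θ | ¬ ‖A - columnProjection (A * Ω θ) * A‖ ≤ ‖B‖ +
      ‖B * Ω θ‖ * √(sketchInvTrace V d (Ω θ))}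
  set E₂ := {θ | 3 * t ^ 2 * (∑ i, 1 / d i) / (p + 1) ≤ sketchInvTrace V d (Ω θ)}
  set E₃ := {θ | ((n + 1 + p : ℕ) : ℝ) * s ^ 2 * (w₀ * ‖B‖ ^ 2) < ‖B * Ω θ‖ ^ 2}
  have hE₁ : P E₁ = 0 := hΩ.ae_norm_sub_columnProjection_le hK (by omega) A hV hd hW
  have hE₂ : P E₂ ≤ ENNReal.ofReal (t ^ p)⁻¹ := hΩ.measure_sketchInvTrace_ge_le hK hp hd hW ht
  have hE₃ : P E₃ ≤ ENNReal.ofReal ((s * Real.exp (-(s ^ 2 - 1) / 2)) ^ (n + 1 + p)) :=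
    hΩ.measure_norm_sq_mul_gt_le hK B hs htr
      (fun h0 => by simpa [hw₀pos.ne'] using h0) (by positivity)
  have hcover : (Set.univ : Set Θ) ⊆ S ∪ (E₁ ∪ (E₂ ∪ E₃)) := by
    intro θ _
    by_contra hθ
    simp only [Set.mem_union, not_or] at hθ
    obtain ⟨hθS, h1, h2, h3⟩ := hθ
    refine hθS ?_
    replace h1 := not_not.1 h1
    replace h2 : sketchInvTrace V d (Ω θ) < 3 * t ^ 2 * (∑ i, 1 / d i) / (p + 1) := not_le.1 h2
    replace h3 : ‖B * Ω θ‖ ^ 2 ≤ ((n + 1 + p : ℕ) : ℝ) * s ^ 2 * (w₀ * ‖B‖ ^ 2) := not_lt.1 h3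
    refine h1.trans ?_
    have h4 : ‖B * Ω θ‖ ^ 2 * sketchInvTrace V d (Ω θ) ≤ (t * s) ^ 2 *
        ((3 * ((n + 1 : ℕ) + p : ℝ) / (p + 1 : ℝ)) * (∑ j : Fin n₁, w j) * Λ) * ‖B‖ ^ 2 := by
      calc _ ≤ (((n + 1 + p : ℕ) : ℝ) * s ^ 2 * ((∑ j, w j) * ‖B‖ ^ 2)) *
            (3 * t ^ 2 * Λ / (p + 1)) := by
            refine mul_le_mul (h3.trans ?_) (h2.le.trans ?_) (sketchInvTrace_nonneg hd _) ?_
            · gcongr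
            · gcongr
            · have := hw₀pos.le.trans hw₀le
              positivity
        _ = _ := by push_cast; ring
    have hts : 0 ≤ t * s := by nlinarith
    have h5 := Real.sqrt_le_sqrt h4
    rw [Real.sqrt_mul (sq_nonneg _), Real.sqrt_sq (norm_nonneg _), Real.sqrt_mul' _ (sq_nonneg _),
      Real.sqrt_mul (sq_nonneg _), Real.sqrt_sq (norm_nonneg _), Real.sqrt_sq hts] at h5
    rw [add_mul, one_mul]
    gcongr
  have hs0 : 0 ≤ (s * Real.exp (-(s ^ 2 - 1) / 2)) ^ (n + 1 + p) := by positivity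
  have ht0 : 0 ≤ (t ^ p)⁻¹ := by positivity
  have hreal : (1 : ℝ) ≤ P.real S + (P.real E₁ + (P.real E₂ + P.real E₃)) := by
    have h := measureReal_mono (μ := P) hcover
    rw [probReal_univ] at h
    refine h.trans ((measureReal_union_le _ _).trans ?_)
    gcongr
    refine (measureReal_union_le _ _).trans ?_
    gcongr
    exact measureReal_union_le _ _
  have r1 : P.real E₁ = 0 := by simp [Measure.real, hE₁]
  have r2 : P.real E₂ ≤ (t ^ p)⁻¹ := ENNReal.toReal_le_of_le_ofReal ht0 hE₂
  have r3 := ENNReal.toReal_le_of_le_ofReal hs0 hE₃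
  change P.real E₃ ≤ _ at r3
  linarith

theorem corollary1 {Θ : Type*} [MeasurableSpace Θ] (P : Measure Θ) [IsProbabilityMeasure P]
    {n₁ n₂ k p : ℕ} (A : Matrix (Fin n₂) (Fin n₁) ℝ)
    (hk : 1 ≤ k) (hkn : k ≤ n₁) (hp : 2 ≤ p)
    (K : Matrix (Fin n₁) (Fin n₁) ℝ) (hK : K.PosDef)
    (Ω : Θ → Matrix (Fin n₁) (Fin (k + p)) ℝ) (hΩ : IsGaussianSketch P K Ω) :
    (Integrable (fun θ => ‖A - columnProjection (A * Ω θ) * A‖) P ∧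
      ∫ θ, ‖A - columnProjection (A * Ω θ) * A‖ ∂P ≤
        (1 + √(((k + p : ℝ) / (p - 1 : ℝ)) *
            ∑ j : Fin n₁ with n₁ - k ≤ j.val,
              sortedEigenvalues hK.isHermitian ⟨0, hk.trans hkn⟩ /
                sortedEigenvalues hK.isHermitian j)) *
          √(∑' j : ℕ, singularValue A (k + j) ^ 2)) ∧
    (4 ≤ p → ∀ s t : ℝ, 1 ≤ s → 1 ≤ t →
      1 - (t ^ p)⁻¹ - (s * Real.exp (-(s ^ 2 - 1) / 2)) ^ (k + p) ≤
        P.real {θ | ‖A - columnProjection (A * Ω θ) * A‖ ≤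
          (1 + t * s * √((3 * (k + p : ℝ) / (p + 1 : ℝ)) *
              (∑ j : Fin n₁, sortedEigenvalues hK.isHermitian j) *
              ∑ j : Fin n₁ with n₁ - k ≤ j.val,
                1 / sortedEigenvalues hK.isHermitian j)) *
            √(∑' j : ℕ, singularValue A (k + j) ^ 2)}) :=
  ⟨hΩ.integral_norm_sub_columnProjection_le A hk hkn hp hK, fun hp4 _ _ hs ht =>
    hΩ.measureReal_norm_sub_columnProjection_le_ge A hk hkn hp4 hK hs ht⟩
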